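/- **Setting.** All measures are Borel measures on $\mathbb R^d$; $\rho$ is the Hellinger distance, $\rho(\mu,\nu)^2=\tfrac12\int(\sqrt{d\mu/d\zeta}-\sqrt{d\nu/d\zeta})^2\,d\zeta$. A finite mixing measure is $\Omega=\sum_{q}\omega_q\delta_q$ with finitely many distinct atoms $q$ (probability measures) and weights $\omega_q>0$, $\sum_q\omega_q=1$; its mixture is $m(\Omega)=\sum_q\omega_q q$. For $r\ge 1$ let $W_r$ be the $L_r$-Wasserstein distance between mixing measures for the ground metric $\rho$. An assignment $\alpha$ labels the atoms of $\Omega$ by $[K]=\{1,\dots,K\}$; put $$\varpi_k(\alpha)=\sum_{\alpha(q)=k}\omega_q,\qquad Q_k(\alpha)=\varpi_k(\alpha)^{-1}\sum_{\alpha(q)=k}\omega_q q .$$ Let $\mathcal K$ be a $\rho$-compact set of nondegenerate Gaussian measures on $\mathbb R^d$, let $\mathfrak Q$ be a set of mixing measures all of whose atoms lie in $\mathcal K$, and let $\mathfrak Q_L$ be the set of those with at most $L$ atoms. For a probability measure $\Gamma$, let $T_L\Gamma$ be the $\rho$-projection of $\Gamma$ on $\{m(\Omega):\Omega\in\mathfrak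 Q_L\}$ and, when it exists uniquely, let $\Omega^*_L\in\mathfrak Q_L$ be its mixing measure, $m(\Omega^*_L)=T_L\Gamma$. A mixing measure $\Lambda=\sum_{k=1}^K\lambda_k\delta_{\gamma_k}$ (distinct $\gamma_k$, $\lambda_k>0$), with $\Gamma=m(\Lambda)$, is *$\mathfrak Q_L$-regular* if $T_L\Gamma$ exists and is unique for all large $L$, $T_L\Gamma\to\Gamma$ in $\rho$, and there are assignments $\alpha_L$ of the atoms of $\Omega^*_L$ (a *regular assignment sequence*) such that, for a suitable numbering of the atoms of $\Lambda$, $Q^*_{L,k}(\alpha_L)\to\gamma_k$ in $\rho$ and $\varpi^*_{L,k}(\alpha_L)\to\lambda_k$ for every $k$. A family $\mathfrak L$ of such $\Lambda$ is *$\mathfrak Q_L$-clusterable* if all its members are regular and there are functions $\chi_L$ such that $\alpha_L=\chi_L(\Omega_L^*)$ is a regular assignment sequence for every $\Lambda\in\mathfrak L$. Members of such a family are called clusterable. Let $\Lambda$ be clusterable, let $Z^{(1)},Z^{(2)},\dots$ be i.i.d. from $\Gamma=m(\Lambda)$, and, for all large $L$, let $\widehat\Omega_{L,n}=\widehat\Omega_{L,n}(Z^{(1)},\dots,Z^{(n)})\in\mathfrak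 Q_L$ satisfy $\lim_{n\to\infty}W_r(\widehat\Omega_{L,n},\Omega^*_L)=0$ almost surely. Let $\widehat\alpha_{L,n}$ be an assignment of the atoms of $\widehat\Omega_{L,n}$ of one of the following two kinds. 1. For every large $L$, almost surely for all large $n$, $\widehat\alpha_{L,n}$ gives each atom of $\widehat\Omega_{L,n}$ the label that $\chi_L(\Omega^*_L)$ gives to a nearest (in $\rho$) atom of $\Omega^*_L$. 2. (NPMIX) For every large $L$, almost surely for all large $n$, $\widehat\Omega_{L,n}$ has as many atoms as $\Omega^*_L$, and $\widehat\alpha_{L,n}$ is the single-linkage clustering, for the distance $\rho$, of the atoms of $\widehat\Omega_{L,n}$ into $K$ clusters (cutting the dendrogram at a height with exactly $K$ clusters whenever there is one). Moreover, for some $\xi>0$, $\rho(\gamma_i,\gamma_j)>(4+\xi)\,\eta(\Lambda)$ for all $i\ne j$, where $$\eta(\Lambda)=\limsup_{L\to\infty}\Big(\sup_k\Delta_k(\alpha_L)+\sup_k\rho(\gamma_k,Q^*_{L,k}(\alpha_L))\Big)$$ for some regular assignment sequence $\alpha_L$, and $\Delta_k(\alpha)$ is the $\rho$-diameter of the convex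 hull of the atoms of $\Omega^*_L$ with label $k$. Let $X\subset\mathbb R^d$ and let $\upsilon$ be any measure on $X$. **Statement.** Each $\gamma_k$ has a (necessarily unique) continuous Lebesgue density $f_k$. Let $c_\Lambda(x)\in\arg\max_k\lambda_kf_k(x)$ be the Bayes classifier, let $\widehat c_{L,n}(x)\in\arg\max_k\widehat\varpi_k\widehat f_k(x)$ be the estimated one, where $\widehat f_k$ is the continuous density of $\widehat Q_k(\widehat\alpha_{L,n})$ and $\widehat\varpi_k=\widehat\varpi_k(\widehat\alpha_{L,n})$ (ties broken arbitrarily), let $A_k=c_\Lambda^{-1}(k)$, $\widehat A_{L,n,k}=\widehat c_{L,n}^{-1}(k)$, and $$E_0(t)=\bigcup_{i\neq j}\{x\in X:|\lambda_if_i(x)-\lambda_jf_j(x)|\le t\},\qquad E_0=E_0(0).$$ Almost surely, after a permutation of the estimated labels (in case 1 a fixed one, in case 2 one that may depend on the sample, $L$ and $n$), there are $t_{L,n}>0$ with $\lim_{L\to\infty}\lim_{n\to\infty}t_{L,n}=0$ such that for all $L,n$ $$\widehat c_{L,n}(x)=c_\Lambda(x)\quad\text{for all }x\in X\setminus E_0(t_{L,n}),\qquad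 \upsilon\Big(\bigcup_{k=1}^KA_k\triangle\widehat A_{L,n,k}\Big)\le\upsilon(E_0(t_{L,n})),$$ and, provided $\upsilon(E_0(\tau))<\infty$ for some $\tau>0$ (for instance if $\upsilon$ is finite), $\lim_{L\to\infty}\lim_{n\to\infty}\upsilon(E_0(t_{L,n}))=\upsilon(E_0)$. -/

import Mathlib

open MeasureTheory ProbabilityTheory Filter Topology
open scoped ENNReal Classical

namespace NPMix

noncomputable section

section General

variable {E : Type*} [MeasurableSpace E]

/-- The Hellinger distance `ρ(μ, ν) = (½ ∫ (√(dμ/dζ) - √(dν/dζ))² dζ)^{1/2}` of two finite measures,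
computed with the dominating measure `ζ = μ + ν` (the value does not depend on `ζ`). -/
def hellinger (μ ν : Measure E) : ℝ :=
  Real.sqrt (2⁻¹ * ∫ x, (Real.sqrt (μ.rnDeriv (μ + ν) x).toReal -
    Real.sqrt (ν.rnDeriv (μ + ν) x).toReal) ^ 2 ∂(μ + ν))

/-- Compactness of a set of probability measures in the Hellinger metric, stated as sequential
compactness. -/
def HellingerCompact (S : Set (ProbabilityMeasure E)) : Prop :=
  ∀ u : ℕ → ProbabilityMeasure E, (∀ n, u n ∈ S) →
    ∃ μ ∈ S, ∃ φ : ℕ → ℕ, StrictMono φ ∧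
      Tendsto (fun n => hellinger (u (φ n) : Measure E) (μ : Measure E)) atTop (𝓝 0)

/-- A finite mixing measure: a finitely supported probability measure `∑_q wt(q) δ_q` on the set of
probability measures on `E`. -/
structure MixMeas (E : Type*) [MeasurableSpace E] where
  wt : ProbabilityMeasure E →₀ ℝ
  nonneg : ∀ q, 0 ≤ wt q
  sum_eq_one : ∑ q ∈ wt.support, wt q = 1

/-- The atoms (mixture components), i.e. the support of the mixing measure. -/
def MixMeas.atoms (Ω : MixMeas E) : Finset (ProbabilityMeasure E) := Ω.wt.support

/-- The mixture distribution `m(Ω) = ∑_q wt(q) q`. -/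
def MixMeas.mix (Ω : MixMeas E) : Measure E :=
  ∑ q ∈ Ω.atoms, ENNReal.ofReal (Ω.wt q) • (q : Measure E)

/-- The `L_r`-Wasserstein distance between finite mixing measures, for the cost `ρ^r`: the infimum
over all couplings `σ` of the two systems of weights. -/
def wasserstein (r : ℝ) (Ω Ω' : MixMeas E) : ℝ :=
  sInf {c : ℝ | ∃ σ : ProbabilityMeasure E → ProbabilityMeasure E → ℝ,
    (∀ p ∈ Ω.atoms, ∀ q ∈ Ω'.atoms, 0 ≤ σ p q) ∧
    (∀ p ∈ Ω.atoms, ∑ q ∈ Ω'.atoms, σ p q = Ω.wt p) ∧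
    (∀ q ∈ Ω'.atoms, ∑ p ∈ Ω.atoms, σ p q = Ω'.wt q) ∧
    c = (∑ p ∈ Ω.atoms, ∑ q ∈ Ω'.atoms,
      σ p q * hellinger (p : Measure E) (q : Measure E) ^ r) ^ (1 / r)}

/-- `𝔔_L`: the members of `𝔔` with at most `L` atoms. -/
def level (𝔔 : Set (MixMeas E)) (L : ℕ) : Set (MixMeas E) := {Ω ∈ 𝔔 | Ω.atoms.card ≤ L}

/-- The `ρ`-projection `T_L Γ`, as the set of all minimizers of `ρ(·, Γ)` over the mixture
distributions `m(Ω)`, `Ω ∈ 𝔔_L`. -/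
def rhoProj (𝔔 : Set (MixMeas E)) (L : ℕ) (Γ : Measure E) : Set (Measure E) :=
  {Q | Q ∈ MixMeas.mix '' level 𝔔 L ∧
    ∀ P ∈ MixMeas.mix '' level 𝔔 L, hellinger Q Γ ≤ hellinger P Γ}

/-- `Ω L` is, for all large `L`, a mixing measure in `𝔔_L` whose mixture is the `ρ`-projection of
`Γ`, i.e. `Ω L = Ω*_L`. -/
def IsProjSeq (𝔔 : Set (MixMeas E)) (Γ : Measure E) (Ω : ℕ → MixMeas E) : Prop :=
  ∀ᶠ L in atTop, Ω L ∈ level 𝔔 L ∧ (Ω L).mix ∈ rhoProj 𝔔 L Γ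

/- An assignment function is a labelling of the atoms of a mixing measure by `Fin K`; it is
represented as a function on all probability measures, of which only the values at the atoms are
ever used. -/

/-- The atoms in the `k`-th cluster: the support of `Ω_k(α)`. -/
def cluster {K : ℕ} (Ω : MixMeas E) (α : ProbabilityMeasure E → Fin K) (k : Fin K) :
    Finset (ProbabilityMeasure E) :=
  Ω.atoms.filter (fun q => α q = k)

/-- The cluster weight `ϖ_k(α) = ∑_{α(q) = k} wt(q)`. -/
def clusterWeight {K : ℕ} (Ω : MixMeas E) (α : ProbabilityMeasure E → Fin K) (k : Fin K) : ℝ :=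
  ∑ q ∈ cluster Ω α k, Ω.wt q

/-- The cluster component `Q_k(α) = ϖ_k(α)⁻¹ ∑_{α(q) = k} wt(q) q`. -/
def clusterMeasure {K : ℕ} (Ω : MixMeas E) (α : ProbabilityMeasure E → Fin K) (k : Fin K) :
    Measure E :=
  ENNReal.ofReal (clusterWeight Ω α k)⁻¹ •
    ∑ q ∈ cluster Ω α k, ENNReal.ofReal (Ω.wt q) • (q : Measure E)

/-- `γ` is an enumeration without repetition of the atoms of `Λ`; in particular `Λ` has exactly `K`
atoms. -/
def Enumerates {K : ℕ} (γ : Fin K → ProbabilityMeasure E) (Λ : MixMeas E) : Prop :=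
  Function.Injective γ ∧ ∀ q, q ∈ Λ.atoms ↔ ∃ k, γ k = q

/-- The limits that define a regular assignment sequence `α` along `Ω = Ω*`:
`Q*_k(α_L) → γ_k` and `ϖ*_k(α_L) → λ_k` for every `k`. -/
def RegularAlong {K : ℕ} (γ : Fin K → ProbabilityMeasure E) (Λ : MixMeas E) (Ω : ℕ → MixMeas E)
    (α : ℕ → ProbabilityMeasure E → Fin K) : Prop :=
  ∀ k, Tendsto (fun L => hellinger (clusterMeasure (Ω L) (α L) k) (γ k : Measure E)) atTop (𝓝 0) ∧
    Tendsto (fun L => clusterWeight (Ω L) (α L) k) atTop (𝓝 (Λ.wt (γ k)))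

/-- `𝔔_L`-regularity of a mixing measure with `K` atoms. -/
structure IsRegular (𝔔 : Set (MixMeas E)) (K : ℕ) (Λ : MixMeas E) : Prop where
  proj_unique : ∃ L₀, ∀ L ≥ L₀, ∃! Q, Q ∈ rhoProj 𝔔 L Λ.mix
  proj_tendsto : ∀ Q : ℕ → Measure E, (∀ᶠ L in atTop, Q L ∈ rhoProj 𝔔 L Λ.mix) →
    Tendsto (fun L => hellinger (Q L) Λ.mix) atTop (𝓝 0)
  assignment : ∀ Ω, IsProjSeq 𝔔 Λ.mix Ω →
    ∃ (γ : Fin K → ProbabilityMeasure E) (α : ℕ → ProbabilityMeasure E → Fin K),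
      Enumerates γ Λ ∧ RegularAlong γ Λ Ω α

/-- `𝔏` is a `𝔔_L`-clusterable family of mixing measures with `K` atoms, and `χ` is a cluster
function for it: every `Λ ∈ 𝔏` is regular and `L ↦ χ_L(Ω*_L)` is a regular assignment sequence for
every `Λ ∈ 𝔏`. -/
structure IsClusterable (𝔔 : Set (MixMeas E)) (K : ℕ) (𝔏 : Set (MixMeas E))
    (χ : ℕ → MixMeas E → ProbabilityMeasure E → Fin K) : Prop where
  regular : ∀ Λ ∈ 𝔏, IsRegular 𝔔 K Λ
  cluster_function : ∀ Λ ∈ 𝔏, ∀ Ω, IsProjSeq 𝔔 Λ.mix Ω →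
    ∃ γ : Fin K → ProbabilityMeasure E,
      Enumerates γ Λ ∧ RegularAlong γ Λ Ω (fun L => χ L (Ω L))

/-- The Hellinger diameter of the convex hull of a finite set of probability measures. -/
def hellingerDiam (s : Finset (ProbabilityMeasure E)) : ℝ :=
  sSup {c : ℝ | ∃ Ω Ω' : MixMeas E, Ω.atoms ⊆ s ∧ Ω'.atoms ⊆ s ∧ c = hellinger Ω.mix Ω'.mix}

/-- `η(α) = sup_k Δ(Ω_k(α)) + sup_k ρ(γ_k, Q_k(α))`. -/
def etaWidth {K : ℕ} (γ : Fin K → ProbabilityMeasure E) (Ω : MixMeas E)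
    (α : ProbabilityMeasure E → Fin K) : ℝ :=
  (⨆ k, hellingerDiam (cluster Ω α k)) +
    ⨆ k, hellinger (γ k : Measure E) (clusterMeasure Ω α k)

/-- `Λ`, with atoms `γ`, is `(4 + ξ) η(Λ)`-separated for some `ξ > 0`, where
`η(Λ) = limsup_L η(α_L)` for a regular assignment sequence `α`. -/
def WellSeparated {K : ℕ} (γ : Fin K → ProbabilityMeasure E) (Λ : MixMeas E)
    (Ω : ℕ → MixMeas E) : Prop :=
  ∃ ξ > (0 : ℝ), ∃ α : ℕ → ProbabilityMeasure E → Fin K, RegularAlong γ Λ Ω α ∧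
    ∀ i j, i ≠ j → (4 + ξ) * limsup (fun L => etaWidth γ (Ω L) (α L)) atTop <
      hellinger (γ i : Measure E) (γ j : Measure E)

/-- `α` labels, with `K` labels all of which occur, the clusters obtained by cutting at height `h`
the single-linkage dendrogram of the points `s` for the distance `ρ`; these are the classes of
points joined by chains in `s` with steps of length at most `h`. -/
def IsSingleLinkageCut {K : ℕ} (s : Finset (ProbabilityMeasure E)) (h : ℝ)
    (α : ProbabilityMeasure E → Fin K) : Prop :=
  (∀ k, ∃ q ∈ s, α q = k) ∧
  ∀ p ∈ s, ∀ q ∈ s, (α p = α q ↔ Relation.ReflTransGen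
    (fun a b => a ∈ s ∧ b ∈ s ∧ hellinger (a : Measure E) (b : Measure E) ≤ h) p q)

/-- `α` is the single-linkage clustering of `s` into `K` clusters, provided that the dendrogram of
`s` has a level with exactly `K` clusters (otherwise `α` is unconstrained). -/
def IsSingleLinkage {K : ℕ} (s : Finset (ProbabilityMeasure E))
    (α : ProbabilityMeasure E → Fin K) : Prop :=
  (∃ (h : ℝ) (β : ProbabilityMeasure E → Fin K), IsSingleLinkageCut s h β) →
    ∃ h : ℝ, IsSingleLinkageCut s h α

/-- `α'` labels every atom of `Ω'` as `α` labels a nearest atom of `Ω`. -/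
def IsNearestLabelling {K : ℕ} (Ω : MixMeas E) (α : ProbabilityMeasure E → Fin K)
    (Ω' : MixMeas E) (α' : ProbabilityMeasure E → Fin K) : Prop :=
  ∀ p ∈ Ω'.atoms, ∃ q ∈ Ω.atoms,
    (∀ q' ∈ Ω.atoms,
      hellinger (p : Measure E) (q : Measure E) ≤ hellinger (p : Measure E) (q' : Measure E)) ∧
    α' p = α q

/-- `lim_{L → ∞} lim_{n → ∞} u L n = a`; the inner limits exist for all large `L`. -/
def IterLim {β : Type*} [TopologicalSpace β] (u : ℕ → ℕ → β) (a : β) : Prop :=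
  ∃ v : ℕ → β, (∀ᶠ L in atTop, Tendsto (u L) atTop (𝓝 (v L))) ∧ Tendsto v atTop (𝓝 a)

end General

section Density

variable {d : ℕ}

/-- Nondegenerate Gaussian measures on `ℝ^d`. -/
def IsNondegGaussian (μ : ProbabilityMeasure (EuclideanSpace ℝ (Fin d))) : Prop :=
  ∃ (a : EuclideanSpace ℝ (Fin d)) (V : Matrix (Fin d) (Fin d) ℝ), V.PosDef ∧
    (μ : Measure (EuclideanSpace ℝ (Fin d))) = multivariateGaussian a V

/-- `g` is a continuous density of `μ` with respect to Lebesgue measure. -/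
def IsContDensity (μ : Measure (EuclideanSpace ℝ (Fin d))) (g : EuclideanSpace ℝ (Fin d) → ℝ) :
    Prop :=
  Continuous g ∧ (∀ x, 0 ≤ g x) ∧ μ = volume.withDensity (fun x => ENNReal.ofReal (g x))

/-- A continuous density is unique as a function. -/
theorem IsContDensity.unique {μ : Measure (EuclideanSpace ℝ (Fin d))}
    {g g' : EuclideanSpace ℝ (Fin d) → ℝ} (h : IsContDensity μ g) (h' : IsContDensity μ g') :
    g = g' := by
  obtain ⟨hc, h0, hμ⟩ := h
  obtain ⟨hc', h0', hμ'⟩ := h'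
  have hae : (fun x => ENNReal.ofReal (g x)) =ᵐ[volume] fun x => ENNReal.ofReal (g' x) := by
    refine (withDensity_eq_iff_of_sigmaFinite ?_ ?_).1 (hμ.symm.trans hμ')
    · exact (ENNReal.measurable_ofReal.comp hc.measurable).aemeasurable
    · exact (ENNReal.measurable_ofReal.comp hc'.measurable).aemeasurable
  refine (hc.ae_eq_iff_eq volume hc').1 ?_
  filter_upwards [hae] with x hx
  exact (ENNReal.ofReal_eq_ofReal_iff (h0 x) (h0' x)).1 hx

/-- The continuous density of `μ` (zero if there is none). -/
def contDensity (μ : Measure (EuclideanSpace ℝ (Fin d))) : EuclideanSpace ℝ (Fin d) → ℝ :=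
  if h : ∃ g, IsContDensity μ g then h.choose else 0

/-- The density `f_k = ϖ_k⁻¹ ∑_{α(q) = k} wt(q) dq/dx` of the cluster component `Q_k(α)`. -/
def clusterDensity {K : ℕ} (Ω : MixMeas (EuclideanSpace ℝ (Fin d)))
    (α : ProbabilityMeasure (EuclideanSpace ℝ (Fin d)) → Fin K) (k : Fin K)
    (x : EuclideanSpace ℝ (Fin d)) : ℝ :=
  (clusterWeight Ω α k)⁻¹ * ∑ q ∈ cluster Ω α k, Ω.wt q * contDensity (q : Measure _) x

/-- `c` is a Bayes classifier on `X` for weights `w` and component densities `f`: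
`c(x) ∈ argmax_k w_k f_k(x)`. -/
def IsBayesClassifier {K : ℕ} (X : Set (EuclideanSpace ℝ (Fin d))) (w : Fin K → ℝ)
    (f : Fin K → EuclideanSpace ℝ (Fin d) → ℝ) (c : X → Fin K) : Prop :=
  ∀ x : X, ∀ j, w j * f j x ≤ w (c x) * f (c x) x

/-- `E_0(t) = ⋃_{i ≠ j} {x ∈ X : |w_i f_i(x) - w_j f_j(x)| ≤ t}`. -/
def exceptional {K : ℕ} (X : Set (EuclideanSpace ℝ (Fin d))) (w : Fin K → ℝ)
    (f : Fin K → EuclideanSpace ℝ (Fin d) → ℝ) (t : ℝ) : Set X :=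
  {x | ∃ i j, i ≠ j ∧ |w i * f i x - w j * f j x| ≤ t}

/-- Consistency of the partitions estimated from the mixing measures `Ω' L n` and assignments
`α' L n`: there are `t_{L,n} > 0` with `lim_L lim_n t_{L,n} = 0` such that every Bayes classifier
`c` and every estimated classifier `c'` agree off `E_0(t_{L,n})`, the union of the
`A_k ∆ A'_{L,n,k}` has `υ`-measure at most `υ(E_0(t_{L,n}))`, and
`lim_L lim_n υ(E_0(t_{L,n})) = υ(E_0)`; the last limit provided that `υ(E_0(τ))` is finite for some
`τ > 0`. -/
def PartitionConsistent {K : ℕ} (X : Set (EuclideanSpace ℝ (Fin d))) (υ : Measure X)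
    (w : Fin K → ℝ) (f : Fin K → EuclideanSpace ℝ (Fin d) → ℝ)
    (Ω' : ℕ → ℕ → MixMeas (EuclideanSpace ℝ (Fin d)))
    (α' : ℕ → ℕ → ProbabilityMeasure (EuclideanSpace ℝ (Fin d)) → Fin K) : Prop :=
  ∃ t : ℕ → ℕ → ℝ, (∀ L n, 0 < t L n) ∧ IterLim t 0 ∧
    (∀ (L n : ℕ) (c c' : X → Fin K), IsBayesClassifier X w f c →
      IsBayesClassifier X (clusterWeight (Ω' L n) (α' L n)) (clusterDensity (Ω' L n) (α' L n)) c' →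
      (∀ x, x ∉ exceptional X w f (t L n) → c' x = c x) ∧
      υ (⋃ k, symmDiff (c ⁻¹' {k}) (c' ⁻¹' {k})) ≤ υ (exceptional X w f (t L n))) ∧
    ((∃ τ > (0 : ℝ), υ (exceptional X w f τ) ≠ ∞) →
      IterLim (fun L n => υ (exceptional X w f (t L n))) (υ (exceptional X w f 0)))

end Density

end

end NPMix

/-! Hellinger closeness of measures says nothing about uniform closeness of densities in general;
here Fourier analysis supplies it. Characteristic functions differ pointwise by at most four times
the Hellinger distance, and compactness of `𝒦` gives one bound `exp (-c ‖t‖²)` for the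
characteristic functions of all its members (`HellingerCompact.exists_charFunDecay`). This bound
survives mixing and Hellinger limits, so the `γ k`, which need not be Gaussian, satisfy it too. By
Fourier inversion all these measures have continuous densities, and dominated convergence turns
Hellinger convergence into uniform convergence of densities.

Two uniform limits result. As `L → ∞`, weighted cluster densities along a regular assignment
sequence tend to those of `Λ` (`RegularAlong.eventually_abs_clusterDensity_sub_le`). For fixed `L`,
as `n → ∞`, a coupling transfers Wasserstein convergence to the estimated weighted cluster
densities, provided nearby atoms carry equal labels (`eventually_abs_clusterDensity_sub_le`). If the
total uniform error is `e`, the two classifiers can disagree only where two weighted densities of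
`Λ` differ by at most `2e`; continuity from above of `υ` gives the last limit
(`partitionConsistent_of_uniform`).

It remains to match labels. Nearest labelling does so once the estimation error is below half the
least distance between atoms of the projection. For single linkage, separation makes the gaps
between clusters exceed their widths, so some cut of the perturbed atoms recovers the clusters, and
any two cuts into `K` clusters agree up to a permutation. -/

namespace NPMix

/-! ### Hellinger distance: triangle inequality and total variation bound. -/

section Hellinger

variable {E : Type*} [MeasurableSpace E]

theorem hellinger_nonneg (μ ν : Measure E) : 0 ≤ hellinger μ ν := Real.sqrt_nonneg _

theorem hellinger_comm (μ ν : Measure E) : hellinger μ ν = hellinger ν μ := by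
  unfold hellinger
  rw [add_comm ν μ]
  congr 2
  exact integral_congr_ae (ae_of_all _ fun x => by ring)

theorem hellinger_self (μ : Measure E) : hellinger μ μ = 0 := by simp [hellinger]

/-- By the chain rule for densities, the factor `d(μ + ν)/dζ` comes out of both square roots and,
squared, becomes the change of measure. This frees the choice of dominating measure, so that several
measures can be compared in one `L²` space. -/
theorem hellinger_eq_sqrt_integral {μ ν ζ : Measure E} [IsFiniteMeasure μ] [IsFiniteMeasure ν]
    [IsFiniteMeasure ζ] (hμ : μ ≪ ζ) (hν : ν ≪ ζ) :
    hellinger μ ν = Real.sqrt (2⁻¹ * ∫ x, (Real.sqrt (μ.rnDeriv ζ x).toReal -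
      Real.sqrt (ν.rnDeriv ζ x).toReal) ^ 2 ∂ζ) := by
  have hs : μ + ν ≪ ζ := Measure.AbsolutelyContinuous.add_left hμ hν
  have h1 : μ ≪ μ + ν := Measure.AbsolutelyContinuous.rfl.add_right ν
  have h2 : ν ≪ μ + ν := by
    rw [add_comm]
    exact Measure.AbsolutelyContinuous.rfl.add_right μ
  unfold hellinger
  congr 2
  rw [← integral_rnDeriv_smul hs]
  refine integral_congr_ae ?_
  filter_upwards [Measure.rnDeriv_mul_rnDeriv (κ := ζ) h1, Measure.rnDeriv_mul_rnDeriv (κ := ζ) h2]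
    with x hx hy
  simp only [Pi.mul_apply] at hx hy
  rw [← hx, ← hy, ENNReal.toReal_mul, ENNReal.toReal_mul,
    Real.sqrt_mul ENNReal.toReal_nonneg, Real.sqrt_mul ENNReal.toReal_nonneg, ← sub_mul, mul_pow,
    Real.sq_sqrt ENNReal.toReal_nonneg, smul_eq_mul, mul_comm]

theorem memLp_sqrt_rnDeriv (μ ζ : Measure E) [IsFiniteMeasure μ] :
    MemLp (fun x => Real.sqrt (μ.rnDeriv ζ x).toReal) 2 ζ := by
  refine (memLp_two_iff_integrable_sq ?_).2 ?_
  · exact (Measure.measurable_rnDeriv μ ζ).ennreal_toReal.sqrt.aestronglyMeasurable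
  · simp only [Real.sq_sqrt ENNReal.toReal_nonneg]
    exact Measure.integrable_toReal_rnDeriv

theorem toReal_eLpNorm_two {ζ : Measure E} {f : E → ℝ} (hf : MemLp f 2 ζ) :
    (eLpNorm f 2 ζ).toReal = Real.sqrt (∫ x, f x ^ 2 ∂ζ) := by
  rw [hf.eLpNorm_eq_integral_rpow_norm (by norm_num) (by norm_num), ENNReal.toReal_ofReal]
  · simp [Real.sqrt_eq_rpow]
  · positivity

theorem hellinger_eq_eLpNorm {μ ν ζ : Measure E} [IsFiniteMeasure μ] [IsFiniteMeasure ν]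
    [IsFiniteMeasure ζ] (hμ : μ ≪ ζ) (hν : ν ≪ ζ) :
    hellinger μ ν = Real.sqrt 2⁻¹ * (eLpNorm ((fun x => Real.sqrt (μ.rnDeriv ζ x).toReal) -
      fun x => Real.sqrt (ν.rnDeriv ζ x).toReal) 2 ζ).toReal := by
  rw [hellinger_eq_sqrt_integral hμ hν,
    toReal_eLpNorm_two ((memLp_sqrt_rnDeriv μ ζ).sub (memLp_sqrt_rnDeriv ν ζ)),
    Real.sqrt_mul (by norm_num)]
  rfl

/-- Minkowski's inequality for the three root densities in `L²(μ + ν + κ)`. -/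
theorem hellinger_triangle (μ ν κ : Measure E) [IsFiniteMeasure μ] [IsFiniteMeasure ν]
    [IsFiniteMeasure κ] : hellinger μ κ ≤ hellinger μ ν + hellinger ν κ := by
  have h1 : μ ≪ μ + ν + κ := (Measure.AbsolutelyContinuous.rfl.add_right ν).add_right κ
  have h2 : ν ≪ μ + ν + κ := by
    refine Measure.AbsolutelyContinuous.add_right ?_ κ
    rw [add_comm]
    exact Measure.AbsolutelyContinuous.rfl.add_right μ
  have h3 : κ ≪ μ + ν + κ := by
    rw [add_comm]
    exact Measure.AbsolutelyContinuous.rfl.add_right _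
  rw [hellinger_eq_eLpNorm h1 h2, hellinger_eq_eLpNorm h2 h3, hellinger_eq_eLpNorm h1 h3, ← mul_add]
  refine mul_le_mul_of_nonneg_left ?_ (Real.sqrt_nonneg _)
  have m12 := (memLp_sqrt_rnDeriv μ (μ + ν + κ)).sub (memLp_sqrt_rnDeriv ν (μ + ν + κ))
  have m23 := (memLp_sqrt_rnDeriv ν (μ + ν + κ)).sub (memLp_sqrt_rnDeriv κ (μ + ν + κ))
  rw [← ENNReal.toReal_add m12.eLpNorm_ne_top m23.eLpNorm_ne_top]
  refine ENNReal.toReal_mono (by simp [m12.eLpNorm_ne_top, m23.eLpNorm_ne_top]) ?_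
  refine le_trans (le_of_eq ?_) (eLpNorm_add_le m12.1 m23.1 (by norm_num))
  congr 1
  abel

theorem integral_toReal_rnDeriv_of_ac {μ ζ : Measure E} [IsProbabilityMeasure μ]
    [IsFiniteMeasure ζ] (h : μ ≪ ζ) : ∫ x, (μ.rnDeriv ζ x).toReal ∂ζ = 1 := by
  rw [Measure.integral_toReal_rnDeriv h]
  simp

theorem ac_add_left (μ ν : Measure E) : μ ≪ μ + ν := Measure.AbsolutelyContinuous.rfl.add_right ν

theorem ac_add_right (μ ν : Measure E) : ν ≪ μ + ν := by
  rw [add_comm]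
  exact ac_add_left ν μ

theorem hellinger_le_one (μ ν : Measure E) [IsProbabilityMeasure μ] [IsProbabilityMeasure ν] :
    hellinger μ ν ≤ 1 := by
  unfold hellinger
  rw [Real.sqrt_le_left one_pos.le, one_pow]
  have hi : Integrable (fun x => (μ.rnDeriv (μ + ν) x).toReal + (ν.rnDeriv (μ + ν) x).toReal)
      (μ + ν) := Measure.integrable_toReal_rnDeriv.add Measure.integrable_toReal_rnDeriv
  have h := integral_mono (((memLp_sqrt_rnDeriv μ (μ + ν)).sub
    (memLp_sqrt_rnDeriv ν (μ + ν))).integrable_sq) hi fun x => by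
      simp only [Pi.sub_apply]
      nlinarith [Real.sq_sqrt (ENNReal.toReal_nonneg (a := μ.rnDeriv (μ + ν) x)),
        Real.sq_sqrt (ENNReal.toReal_nonneg (a := ν.rnDeriv (μ + ν) x)),
        mul_nonneg (Real.sqrt_nonneg (μ.rnDeriv (μ + ν) x).toReal)
          (Real.sqrt_nonneg (ν.rnDeriv (μ + ν) x).toReal)]
  rw [integral_add Measure.integrable_toReal_rnDeriv Measure.integrable_toReal_rnDeriv,
    integral_toReal_rnDeriv_of_ac (ac_add_left μ ν),
    integral_toReal_rnDeriv_of_ac (ac_add_right μ ν)] at h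
  simp only [Pi.sub_apply] at h
  linarith

/-- With root densities `a` and `b`, apply Cauchy-Schwarz to `|a² - b²| = |a - b| (a + b)`. The
factors have `L²` norms `√2 ρ ≤ 2ρ` and at most `2`; the constant is not sharp. -/
theorem integral_abs_rnDeriv_sub_le (μ ν : Measure E) [IsProbabilityMeasure μ]
    [IsProbabilityMeasure ν] :
    ∫ x, |(μ.rnDeriv (μ + ν) x).toReal - (ν.rnDeriv (μ + ν) x).toReal| ∂(μ + ν) ≤
      4 * hellinger μ ν := by
  set ζ := μ + ν with hζ
  set a := fun x => Real.sqrt (μ.rnDeriv ζ x).toReal with ha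
  set b := fun x => Real.sqrt (ν.rnDeriv ζ x).toReal with hb
  have hma : MemLp a 2 ζ := memLp_sqrt_rnDeriv μ ζ
  have hmb : MemLp b 2 ζ := memLp_sqrt_rnDeriv ν ζ
  have ha2 : ∀ x, a x ^ 2 = (μ.rnDeriv ζ x).toReal := fun x => Real.sq_sqrt ENNReal.toReal_nonneg
  have hb2 : ∀ x, b x ^ 2 = (ν.rnDeriv ζ x).toReal := fun x => Real.sq_sqrt ENNReal.toReal_nonneg
  have ha0 : ∀ x, 0 ≤ a x := fun x => Real.sqrt_nonneg _
  have hb0 : ∀ x, 0 ≤ b x := fun x => Real.sqrt_nonneg _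
  have hcs := integral_mul_le_Lp_mul_Lq_of_nonneg (μ := ζ) (p := 2) (q := 2)
    (f := fun x => |a x - b x|) (g := fun x => a x + b x) Real.HolderConjugate.two_two
    (ae_of_all _ fun x => abs_nonneg _) (ae_of_all _ fun x => add_nonneg (ha0 x) (hb0 x))
    (by simpa using (hma.sub hmb).norm) (by rw [ENNReal.ofReal_ofNat]; exact hma.add hmb)
  have hI : ∫ x, (a x + b x) ^ 2 ∂ζ ≤ 4 := by
    have h := integral_mono (μ := ζ) (f := fun x => (a x + b x) ^ 2)
      (g := fun x => 2 * ((μ.rnDeriv ζ x).toReal + (ν.rnDeriv ζ x).toReal))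
      (hma.add hmb).integrable_sq
      ((Measure.integrable_toReal_rnDeriv.add Measure.integrable_toReal_rnDeriv).const_mul 2)
      fun x => by
        simp only [← ha2, ← hb2]
        nlinarith [sq_nonneg (a x - b x)]
    rw [integral_const_mul,
      integral_add Measure.integrable_toReal_rnDeriv Measure.integrable_toReal_rnDeriv,
      integral_toReal_rnDeriv_of_ac (ac_add_left μ ν),
      integral_toReal_rnDeriv_of_ac (ac_add_right μ ν)] at h
    linarith
  have hJ : Real.sqrt (∫ x, (a x - b x) ^ 2 ∂ζ) ≤ 2 * hellinger μ ν := by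
    have h0 : 0 ≤ ∫ x, (a x - b x) ^ 2 ∂ζ := integral_nonneg fun x => sq_nonneg _
    rw [Real.sqrt_le_left (by have := hellinger_nonneg μ ν; positivity), mul_pow, hellinger,
      Real.sq_sqrt (by positivity)]
    simp only [ha, hb, hζ] at h0 ⊢
    linarith
  have hrew : ∀ x, |(μ.rnDeriv ζ x).toReal - (ν.rnDeriv ζ x).toReal| = |a x - b x| * (a x + b x) :=
    fun x => by
      rw [← ha2, ← hb2, sq_sub_sq, abs_mul, abs_of_nonneg (add_nonneg (ha0 x) (hb0 x)), mul_comm]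
  simp only [hrew]
  refine hcs.trans ?_
  simp only [Real.rpow_two, sq_abs, ← Real.sqrt_eq_rpow]
  have hK : Real.sqrt (∫ x, (a x + b x) ^ 2 ∂ζ) ≤ 2 :=
    (Real.sqrt_le_sqrt hI).trans (by rw [show (4 : ℝ) = 2 ^ 2 by norm_num]; simp)
  calc _ ≤ (2 * hellinger μ ν) * 2 :=
        mul_le_mul hJ hK (Real.sqrt_nonneg _) (by have := hellinger_nonneg μ ν; positivity)
    _ = _ := by ring

/-- The total variation bound by the Hellinger distance, in integrated form. -/
theorem norm_integral_sub_le_hellinger (μ ν : Measure E) [IsProbabilityMeasure μ]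
    [IsProbabilityMeasure ν] {f : E → ℂ} (hf : Measurable f) (hf1 : ∀ x, ‖f x‖ ≤ 1) :
    ‖∫ x, f x ∂μ - ∫ x, f x ∂ν‖ ≤ 4 * hellinger μ ν := by
  rw [← integral_rnDeriv_smul (ac_add_left μ ν), ← integral_rnDeriv_smul (ac_add_right μ ν)]
  have hi : ∀ κ : Measure E, [IsFiniteMeasure κ] → Integrable
      (fun x => (κ.rnDeriv (μ + ν) x).toReal • f x) (μ + ν) := fun κ _ =>
    Integrable.smul_bdd Measure.integrable_toReal_rnDeriv 1
      hf.aestronglyMeasurable (ae_of_all _ hf1)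
  rw [← integral_sub (hi μ) (hi ν)]
  refine (norm_integral_le_integral_norm _).trans ?_
  refine le_trans ?_ (integral_abs_rnDeriv_sub_le μ ν)
  refine integral_mono ((hi μ).sub (hi ν)).norm
    ((Measure.integrable_toReal_rnDeriv.sub Measure.integrable_toReal_rnDeriv).norm) fun x => ?_
  simp only [← sub_smul, norm_smul, Real.norm_eq_abs]
  exact mul_le_of_le_one_right (abs_nonneg _) (hf1 x)

end Hellinger

/-! ### Fourier inversion for finite measures. -/

section FourierInversion

open scoped FourierTransform RealInnerProductSpace

variable {V : Type*} [NormedAddCommGroup V] [InnerProductSpace ℝ V] [FiniteDimensional ℝ V]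
  [MeasurableSpace V] [BorelSpace V]

theorem isLocallyFiniteMeasure_add {E : Type*} [TopologicalSpace E] [MeasurableSpace E]
    (μ ν : Measure E) [IsLocallyFiniteMeasure μ]
    [IsLocallyFiniteMeasure ν] : IsLocallyFiniteMeasure (μ + ν) := by
  refine ⟨fun x => ?_⟩
  obtain ⟨s, hs, hμ⟩ := μ.finiteAt_nhds x
  obtain ⟨t, ht, hν⟩ := ν.finiteAt_nhds x
  refine ⟨s ∩ t, inter_mem hs ht, ?_⟩
  rw [Measure.add_apply]
  exact ENNReal.add_lt_top.2 ⟨(measure_mono Set.inter_subset_left).trans_lt hμ,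
    (measure_mono Set.inter_subset_right).trans_lt hν⟩

/-- Locally finite measures that agree on smooth compactly supported functions are equal. -/
theorem ext_of_integral_contDiff {μ ν : Measure V} [IsLocallyFiniteMeasure μ]
    [IsLocallyFiniteMeasure ν]
    (h : ∀ g : V → ℝ, ContDiff ℝ (⊤ : ℕ∞) g → HasCompactSupport g → ∫ x, g x ∂μ = ∫ x, g x ∂ν) :
    μ = ν := by
  have := isLocallyFiniteMeasure_add μ ν
  -- Densities with respect to `μ + ν` are bounded by `1`, hence locally integrable, so the
  -- fundamental lemma of the calculus of variations applies to them.
  have hloc : ∀ κ : Measure V, κ ≤ μ + ν →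
      LocallyIntegrable (fun x => (κ.rnDeriv (μ + ν) x).toReal) (μ + ν) := by
    intro κ hκ
    refine (locallyIntegrable_const (1 : ℝ)).mono
      (Measure.measurable_rnDeriv κ _).ennreal_toReal.aestronglyMeasurable ?_
    filter_upwards [Measure.rnDeriv_le_one_of_le hκ] with x hx
    rw [Real.norm_of_nonneg ENNReal.toReal_nonneg, norm_one]
    exact ENNReal.toReal_le_of_le_ofReal one_pos.le (by simpa using hx)
  have hle : μ ≤ μ + ν := Measure.le_add_right le_rfl
  have hle' : ν ≤ μ + ν := Measure.le_add_left le_rfl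
  have hae := ae_eq_of_integral_contDiff_smul_eq (hloc μ hle) (hloc ν hle') fun g hg hgs => by
    simp only [smul_eq_mul, mul_comm (g _)]
    exact (integral_rnDeriv_smul (ac_add_left μ ν)).trans
      ((h g hg hgs).trans (integral_rnDeriv_smul (ac_add_right μ ν)).symm)
  have hae' : μ.rnDeriv (μ + ν) =ᵐ[μ + ν] ν.rnDeriv (μ + ν) := by
    filter_upwards [hae, Measure.rnDeriv_lt_top μ (μ + ν), Measure.rnDeriv_lt_top ν (μ + ν)]
      with x hx h1 h2
    exact (ENNReal.toReal_eq_toReal_iff' h1.ne h2.ne).1 hx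
  exact (Measure.withDensity_rnDeriv_eq _ _ (ac_add_left μ ν)).symm.trans
    ((withDensity_congr_ae hae').trans (Measure.withDensity_rnDeriv_eq _ _ (ac_add_right μ ν)))

/-- The function with characteristic function `φ`, by Fourier inversion. -/
noncomputable def inversionIntegral (φ : V → ℂ) (x : V) : ℂ :=
  𝓕⁻ (fun t => φ (-(2 * Real.pi) • t)) x

/-- Write the test function as the Fourier transform of its inverse transform and use the exchange
formula twice: once to move the transform onto `μ`, which produces its characteristic function, and
once to move the inverse transform onto that characteristic function. The scaling `-(2π)` reconciles
`exp(i⟨x,t⟩)` with `exp(-2πi⟨x,t⟩)`. -/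
theorem integral_contDiff_eq_inversionIntegral {μ : Measure V} [IsFiniteMeasure μ]
    (hφ : Integrable (fun t => charFun μ (-(2 * Real.pi) • t))) {g : V → ℝ}
    (hg : ContDiff ℝ (⊤ : ℕ∞) g) (hgs : HasCompactSupport g) :
    ((∫ x, g x ∂μ : ℝ) : ℂ) = ∫ x, (g x : ℂ) * inversionIntegral (charFun μ) x := by
  have hu : ContDiff ℝ (⊤ : ℕ∞) (fun x => (g x : ℂ)) := Complex.ofRealCLM.contDiff.comp hg
  have hus : HasCompactSupport (fun x => (g x : ℂ)) := hgs.comp_left Complex.ofReal_zero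
  set u : SchwartzMap V ℂ := hus.toSchwartzMap hu
  have hux : ∀ x, u x = (g x : ℂ) := fun x => rfl
  have hinv : 𝓕 (𝓕⁻ (u : V → ℂ)) = u := u.continuous.fourier_fourierInv_eq u.integrable (by
    rw [← SchwartzMap.fourier_coe]
    exact (𝓕 u).integrable)
  have hint : Integrable (𝓕⁻ (u : V → ℂ)) := by
    rw [← SchwartzMap.fourierInv_coe]
    exact (𝓕⁻ u).integrable
  have h1 := VectorFourier.integral_fourierIntegral_smul_eq_flip (e := Real.fourierChar)
    (μ := (volume : Measure V)) (ν := μ) (L := innerₗ V) (f := 𝓕⁻ (u : V → ℂ)) (g := (1 : V → ℂ))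
    Real.continuous_fourierChar continuous_inner hint (integrable_const 1)
  -- The pairing `-innerₗ V` makes the transform an inverse Fourier transform.
  have h2 := VectorFourier.integral_fourierIntegral_smul_eq_flip (e := Real.fourierChar)
    (μ := (volume : Measure V)) (ν := (volume : Measure V)) (L := -innerₗ V) (f := (u : V → ℂ))
    (g := fun t => charFun μ (-(2 * Real.pi) • t))
    Real.continuous_fourierChar continuous_inner.neg u.integrable hφ
  have hflip : (innerₗ V).flip = innerₗ V := by
    ext x y
    simp
  have hflip' : (-innerₗ V).flip = -innerₗ V := by
    ext x y
    simp [real_inner_comm]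
  have hchar : ∀ t, charFun μ (-(2 * Real.pi) • t) =
      VectorFourier.fourierIntegral Real.fourierChar μ (innerₗ V) (1 : V → ℂ) t := fun t => by
    rw [charFun_eq_fourierIntegral', smul_smul]
    congr 1
    have := Real.pi_ne_zero
    rw [show -(2 * Real.pi)⁻¹ * -(2 * Real.pi) = 1 by field_simp, one_smul]
  rw [hflip] at h1
  rw [hflip'] at h2
  have hA : ∫ x, (u x : ℂ) ∂μ = ((∫ x, g x ∂μ : ℝ) : ℂ) := by
    simp only [hux]
    exact integral_complex_ofReal
  rw [← hA]
  calc ∫ x, u x ∂μ = ∫ x, 𝓕 (𝓕⁻ (u : V → ℂ)) x • (1 : V → ℂ) x ∂μ := by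
        rw [hinv]; simp
    _ = _ := h1
    _ = ∫ x, 𝓕⁻ (u : V → ℂ) x • charFun μ (-(2 * Real.pi) • x) := by simp only [hchar]
    _ = _ := h2
    _ = _ := rfl

theorem continuous_inversionIntegral {φ : V → ℂ}
    (hφ : Integrable (fun t => φ (-(2 * Real.pi) • t))) : Continuous (inversionIntegral φ) :=
  VectorFourier.fourierIntegral_continuous Real.continuous_fourierChar continuous_inner.neg hφ

theorem integral_withDensity_ofReal {f : V → ℝ} (hf : Continuous f) (g : V → ℝ) :
    ∫ x, g x ∂(volume.withDensity fun x => ENNReal.ofReal (f x)) = ∫ x, max (f x) 0 * g x := by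
  rw [integral_withDensity_eq_integral_toReal_smul
    (f := fun x => ENNReal.ofReal (f x)) (by fun_prop) (ae_of_all _ fun x => ENNReal.ofReal_lt_top)]
  simp [ENNReal.toReal_ofReal']

/-- The sign of `f` is not known beforehand. Testing gives `μ + f⁻ dx = f⁺ dx`; the right side
vanishes on `{f < 0}`, which carries all of `f⁻ dx`. Hence `f⁻ dx = 0`, and `f ≥ 0` everywhere by
continuity. -/
theorem eq_withDensity_of_integral_contDiff {μ : Measure V} [IsFiniteMeasure μ] {f : V → ℝ}
    (hf : Continuous f) (h : ∀ g : V → ℝ, ContDiff ℝ (⊤ : ℕ∞) g → HasCompactSupport g →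
      ∫ x, g x ∂μ = ∫ x, g x * f x) :
    (∀ x, 0 ≤ f x) ∧ μ = volume.withDensity (fun x => ENNReal.ofReal (f x)) := by
  set ν₁ := (volume : Measure V).withDensity (fun x => ENNReal.ofReal (f x)) with hν₁
  set ν₂ := (volume : Measure V).withDensity (fun x => ENNReal.ofReal (-f x)) with hν₂
  have hneg : Continuous fun x => -f x := hf.neg
  have : IsLocallyFiniteMeasure ν₁ := IsLocallyFiniteMeasure.withDensity_ofReal hf
  have : IsLocallyFiniteMeasure ν₂ := IsLocallyFiniteMeasure.withDensity_ofReal hf.neg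
  have := isLocallyFiniteMeasure_add μ ν₂
  have heq : μ + ν₂ = ν₁ := by
    refine ext_of_integral_contDiff fun g hg hgs => ?_
    have hi : ∀ κ : Measure V, [IsLocallyFiniteMeasure κ] → Integrable g κ := fun κ _ =>
      hg.continuous.integrable_of_hasCompactSupport hgs
    rw [integral_add_measure (hi μ) (hi ν₂), h g hg hgs, hν₁, hν₂, integral_withDensity_ofReal hf,
      integral_withDensity_ofReal hneg, ← integral_add]
    · refine integral_congr_ae (ae_of_all _ fun x => ?_)
      simp only
      rcases le_total 0 (f x) with h0 | h0
      · rw [max_eq_left h0, max_eq_right (by linarith)]; ring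
      · rw [max_eq_right h0, max_eq_left (by linarith)]; ring
    · exact (hg.continuous.mul hf).integrable_of_hasCompactSupport hgs.mul_right
    · exact ((hf.neg.max continuous_const).mul hg.continuous).integrable_of_hasCompactSupport
        hgs.mul_left
  have hm : MeasurableSet {x | f x < 0} := measurableSet_lt hf.measurable measurable_const
  have h1 : ν₁ {x | f x < 0} = 0 := by
    rw [hν₁, withDensity_apply _ hm]
    refine (setLIntegral_congr_fun (g := 0) hm fun x hx => ?_).trans (by simp)
    exact ENNReal.ofReal_of_nonpos (le_of_lt hx)
  have h2 : ν₂ {x | f x < 0} = 0 := by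
    refine le_antisymm ?_ bot_le
    rw [← h1, ← heq]
    exact Measure.le_iff'.1 (Measure.le_add_left le_rfl) _
  have h3 : ν₂ {x | f x < 0}ᶜ = 0 := by
    rw [hν₂, withDensity_apply _ hm.compl]
    refine (setLIntegral_congr_fun (g := 0) hm.compl fun x hx => ?_).trans (by simp)
    simp only [Set.mem_compl_iff, Set.mem_ofPred_eq, not_lt] at hx
    exact ENNReal.ofReal_of_nonpos (by linarith)
  have h4 : ν₂ = 0 := by
    rw [← Measure.measure_univ_eq_zero, ← Set.union_compl_self {x | f x < 0}]
    exact measure_union_null h2 h3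
  refine ⟨?_, by rw [← heq, h4, add_zero]⟩
  have h5 : (fun x => ENNReal.ofReal (-f x)) =ᵐ[volume] 0 :=
    (withDensity_eq_zero_iff (ENNReal.measurable_ofReal.comp hf.neg.measurable).aemeasurable).1 h4
  have h6 : (fun x => ENNReal.ofReal (-f x)) = 0 :=
    ((ENNReal.continuous_ofReal.comp hf.neg).ae_eq_iff_eq volume continuous_const).1 h5
  intro x
  have := congrFun h6 x
  simp only [Pi.zero_apply, ENNReal.ofReal_eq_zero] at this
  linarith

/-- Fourier inversion for finite measures with integrable characteristic function. -/
theorem eq_withDensity_inversionIntegral {μ : Measure V} [IsFiniteMeasure μ]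
    (hφ : Integrable (fun t => charFun μ (-(2 * Real.pi) • t))) :
    (∀ x, 0 ≤ (inversionIntegral (charFun μ) x).re) ∧
      μ = volume.withDensity (fun x => ENNReal.ofReal (inversionIntegral (charFun μ) x).re) := by
  have hc := continuous_inversionIntegral hφ
  refine eq_withDensity_of_integral_contDiff (Complex.continuous_re.comp hc) fun g hg hgs => ?_
  have h := congrArg Complex.re (integral_contDiff_eq_inversionIntegral hφ hg hgs)
  rw [Complex.ofReal_re] at h
  rw [h, ← RCLike.re_eq_complex_re, ← integral_re]
  · simp
  · refine Continuous.integrable_of_hasCompactSupport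
      ((Complex.continuous_ofReal.comp hg.continuous).mul hc) ?_
    exact (hgs.comp_left Complex.ofReal_zero).mul_right

theorem norm_inversionIntegral_sub_le {φ ψ : V → ℂ}
    (hφ : Integrable (fun t => φ (-(2 * Real.pi) • t)))
    (hψ : Integrable (fun t => ψ (-(2 * Real.pi) • t))) (x : V) :
    ‖inversionIntegral φ x - inversionIntegral ψ x‖ ≤
      ∫ t, ‖φ (-(2 * Real.pi) • t) - ψ (-(2 * Real.pi) • t)‖ := by
  have h := VectorFourier.fourierIntegral_add Real.continuous_fourierChar
    (L := -innerₗ V) continuous_inner.neg (hφ.sub hψ) hψ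
  rw [sub_add_cancel] at h
  have h' : inversionIntegral φ x - inversionIntegral ψ x = VectorFourier.fourierIntegral
      Real.fourierChar volume (-innerₗ V)
      ((fun t => φ (-(2 * Real.pi) • t)) - fun t => ψ (-(2 * Real.pi) • t)) x :=
    sub_eq_iff_eq_add.2 (congrFun h x)
  rw [h']
  exact VectorFourier.norm_fourierIntegral_le_integral_norm _ _ _ _ _

theorem norm_inversionIntegral_le (φ : V → ℂ) (x : V) :
    ‖inversionIntegral φ x‖ ≤ ∫ t, ‖φ (-(2 * Real.pi) • t)‖ :=
  VectorFourier.norm_fourierIntegral_le_integral_norm _ _ _ _ _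

end FourierInversion

/-! ### Gaussian decay of characteristic functions and uniform convergence of densities. -/

section CharFunDecay

open scoped FourierTransform RealInnerProductSpace

/-- The characteristic function of `μ` is bounded by `exp (-c ‖t‖²)`. -/
def CharFunDecay {V : Type*} [NormedAddCommGroup V] [InnerProductSpace ℝ V] [MeasurableSpace V]
    (c : ℝ) (μ : Measure V) : Prop :=
  ∀ t, ‖charFun μ t‖ ≤ Real.exp (-c * ‖t‖ ^ 2)

theorem CharFunDecay.of_tendsto {V : Type*} [NormedAddCommGroup V]
    [InnerProductSpace ℝ V] [MeasurableSpace V] {ι : Type*} {l : Filter ι} [l.NeBot] {c : ℝ}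
    {μ : ι → Measure V}
    {ν : Measure V} (hμ : ∀ᶠ i in l, CharFunDecay c (μ i))
    (h : ∀ t, Tendsto (fun i => charFun (μ i) t) l (𝓝 (charFun ν t))) : CharFunDecay c ν :=
  fun t => le_of_tendsto (h t).norm (hμ.mono fun _ hi => hi t)

section

variable {V : Type*} [NormedAddCommGroup V] [InnerProductSpace ℝ V] [MeasurableSpace V]
  [BorelSpace V]

theorem norm_charFun_sub_le_hellinger (μ ν : Measure V) [IsProbabilityMeasure μ]
    [IsProbabilityMeasure ν] (t : V) : ‖charFun μ t - charFun ν t‖ ≤ 4 * hellinger μ ν := by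
  rw [charFun_apply, charFun_apply]
  refine norm_integral_sub_le_hellinger μ ν ?_ fun x => (Complex.norm_exp_ofReal_mul_I _).le
  exact Continuous.measurable (by fun_prop)

theorem tendsto_charFun_of_hellinger {ι : Type*} {l : Filter ι} {μ : ι → Measure V} {ν : Measure V}
    [IsProbabilityMeasure ν] (hμ : ∀ᶠ i in l, IsProbabilityMeasure (μ i))
    (h : Tendsto (fun i => hellinger (μ i) ν) l (𝓝 0)) (t : V) :
    Tendsto (fun i => charFun (μ i) t) l (𝓝 (charFun ν t)) := by
  rw [tendsto_iff_norm_sub_tendsto_zero]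
  refine squeeze_zero' (Eventually.of_forall fun _ => norm_nonneg _) ?_
    (by simpa using h.const_mul 4)
  filter_upwards [hμ] with i hi
  exact norm_charFun_sub_le_hellinger (μ i) ν t

variable [FiniteDimensional ℝ V]

theorem integrable_exp_neg_mul_sq_norm {c : ℝ} (hc : 0 < c) :
    Integrable fun t : V => Real.exp (-c * ‖-(2 * Real.pi) • t‖ ^ 2) := by
  have hb : 0 < ((c * (2 * Real.pi) ^ 2 : ℝ) : ℂ).re := by
    rw [Complex.ofReal_re]
    have := Real.pi_pos
    positivity
  have h := (GaussianFourier.integrable_cexp_neg_mul_sq_norm_add hb 0 (0 : V)).norm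
  refine h.congr (ae_of_all _ fun t => ?_)
  simp only [Complex.norm_exp]
  congr 1
  rw [norm_smul, mul_pow (‖-(2 * Real.pi)‖), norm_neg, Real.norm_eq_abs, sq_abs]
  simp [← Complex.ofReal_pow, ← Complex.ofReal_mul, ← Complex.ofReal_neg]
  ring

theorem integrable_of_norm_le_exp {φ : V → ℂ} (hm : Measurable φ) {c : ℝ} (hc : 0 < c)
    (h : ∀ t, ‖φ t‖ ≤ Real.exp (-c * ‖t‖ ^ 2)) :
    Integrable fun t => φ (-(2 * Real.pi) • t) := by
  refine (integrable_exp_neg_mul_sq_norm hc).mono' ?_ (ae_of_all _ fun t => h _)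
  exact (hm.comp (measurable_const_smul _)).aestronglyMeasurable

/-- The common Gaussian bound upgrades pointwise convergence to `L¹` convergence by domination, and
the `L¹` distance bounds the inversion integrals uniformly in `x`. -/
theorem eventually_norm_inversionIntegral_sub_le {ι : Type*} {l : Filter ι}
    [l.IsCountablyGenerated] {φ : ι → V → ℂ} {ψ : V → ℂ} {c : ℝ} (hc : 0 < c)
    (hφm : ∀ᶠ i in l, Measurable (φ i))
    (hφ : ∀ᶠ i in l, ∀ t, ‖φ i t‖ ≤ Real.exp (-c * ‖t‖ ^ 2)) (hψm : Measurable ψ)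
    (hψ : ∀ t, ‖ψ t‖ ≤ Real.exp (-c * ‖t‖ ^ 2))
    (h : ∀ t, Tendsto (fun i => φ i t) l (𝓝 (ψ t))) {ε : ℝ} (hε : 0 < ε) :
    ∀ᶠ i in l, ∀ x, ‖inversionIntegral (φ i) x - inversionIntegral ψ x‖ ≤ ε := by
  have hlim : Tendsto (fun i => ∫ t, ‖φ i (-(2 * Real.pi) • t) - ψ (-(2 * Real.pi) • t)‖) l
      (𝓝 (∫ _ : V, (0 : ℝ))) := by
    refine tendsto_integral_filter_of_dominated_convergence
      (fun t => 2 * Real.exp (-c * ‖-(2 * Real.pi) • t‖ ^ 2)) ?_ ?_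
      ((integrable_exp_neg_mul_sq_norm hc).const_mul 2) ?_
    · filter_upwards [hφm] with i hi
      exact ((hi.comp (measurable_const_smul _)).sub
        (hψm.comp (measurable_const_smul _))).norm.aestronglyMeasurable
    · filter_upwards [hφ] with i hi
      refine ae_of_all _ fun t => ?_
      rw [norm_norm]
      have := norm_sub_le (φ i (-(2 * Real.pi) • t)) (ψ (-(2 * Real.pi) • t))
      linarith [hi (-(2 * Real.pi) • t), hψ (-(2 * Real.pi) • t)]
    · exact ae_of_all _ fun t => tendsto_iff_norm_sub_tendsto_zero.1 (h _)
  rw [integral_zero] at hlim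
  filter_upwards [hφm, hφ, hlim.eventually_le_const hε] with i h1 h2 h3 x
  exact (norm_inversionIntegral_sub_le (integrable_of_norm_le_exp h1 hc h2)
    (integrable_of_norm_le_exp hψm hc hψ) x).trans h3

theorem norm_inversionIntegral_le_of_le_exp {φ : V → ℂ} (hm : Measurable φ) {c : ℝ} (hc : 0 < c)
    (h : ∀ t, ‖φ t‖ ≤ Real.exp (-c * ‖t‖ ^ 2)) (x : V) :
    ‖inversionIntegral φ x‖ ≤ ∫ t : V, Real.exp (-c * ‖-(2 * Real.pi) • t‖ ^ 2) :=
  (norm_inversionIntegral_le φ x).trans (integral_mono (integrable_of_norm_le_exp hm hc h).norm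
    (integrable_exp_neg_mul_sq_norm hc) fun _ => h _)

theorem inversionIntegral_sum {ι : Type*} (s : Finset ι) (a : ι → ℂ) (φ : ι → V → ℂ)
    (h : ∀ i ∈ s, Integrable fun t => φ i (-(2 * Real.pi) • t)) (x : V) :
    inversionIntegral (fun t => ∑ i ∈ s, a i * φ i t) x =
      ∑ i ∈ s, a i * inversionIntegral (φ i) x := by
  simp only [inversionIntegral, Real.fourierInv_eq, Finset.smul_sum]
  rw [integral_finsetSum]
  · refine Finset.sum_congr rfl fun i _ => ?_
    rw [← integral_const_mul]
    simp only [mul_smul_comm]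
  · intro i hi
    have := (VectorFourier.fourierIntegral_convergent_iff (L := -innerₗ V)
      Real.continuous_fourierChar continuous_inner.neg x).2 ((h i hi).const_mul (a i))
    simpa using this

end

section Euclidean

variable {d : ℕ}

theorem CharFunDecay.isContDensity {c : ℝ} (hc : 0 < c)
    {μ : Measure (EuclideanSpace ℝ (Fin d))} [IsFiniteMeasure μ] (h : CharFunDecay c μ) :
    IsContDensity μ fun x => (inversionIntegral (charFun μ) x).re := by
  have hi := integrable_of_norm_le_exp measurable_charFun hc h
  obtain ⟨h0, h1⟩ := eq_withDensity_inversionIntegral hi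
  exact ⟨Complex.continuous_re.comp (continuous_inversionIntegral hi), h0, h1⟩

theorem IsContDensity.contDensity_eq {μ : Measure (EuclideanSpace ℝ (Fin d))}
    {g : EuclideanSpace ℝ (Fin d) → ℝ} (h : IsContDensity μ g) : contDensity μ = g := by
  have hex : ∃ g, IsContDensity μ g := ⟨g, h⟩
  rw [contDensity, dif_pos hex]
  exact hex.choose_spec.unique h

theorem CharFunDecay.contDensity_eq {c : ℝ} (hc : 0 < c)
    {μ : Measure (EuclideanSpace ℝ (Fin d))} [IsFiniteMeasure μ] (h : CharFunDecay c μ)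
    (x : EuclideanSpace ℝ (Fin d)) : contDensity μ x = (inversionIntegral (charFun μ) x).re :=
  congrFun (h.isContDensity hc).contDensity_eq x

theorem norm_charFun_multivariateGaussian {V : Matrix (Fin d) (Fin d) ℝ} (hV : V.PosDef)
    (a t : EuclideanSpace ℝ (Fin d)) : ‖charFun (multivariateGaussian a V) t‖ =
      Real.exp (-(t.ofLp ⬝ᵥ V.mulVec t.ofLp) / 2) := by
  rw [charFun_multivariateGaussian hV.posSemidef, Complex.norm_exp]
  simp [neg_div]

/-- The modulus of a Gaussian characteristic function is the exponential of a quadratic form, so a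
bound on the unit sphere extends by homogeneity. -/
theorem IsNondegGaussian.charFunDecay_of_sphere
    {μ : ProbabilityMeasure (EuclideanSpace ℝ (Fin d))} (hμ : IsNondegGaussian μ) {c : ℝ}
    (h : ∀ u : EuclideanSpace ℝ (Fin d), ‖u‖ = 1 →
      ‖charFun (μ : Measure (EuclideanSpace ℝ (Fin d))) u‖ ≤ Real.exp (-c)) :
    CharFunDecay c (μ : Measure (EuclideanSpace ℝ (Fin d))) := by
  obtain ⟨a, V, hV, hμ⟩ := hμ
  intro t
  rcases eq_or_ne t 0 with rfl | ht
  · simp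
  have ht' : ‖t‖ ≠ 0 := norm_ne_zero_iff.2 ht
  have h1 := h (‖t‖⁻¹ • t) (by rw [norm_smul, norm_inv, norm_norm, inv_mul_cancel₀ ht'])
  rw [hμ, norm_charFun_multivariateGaussian hV, Real.exp_le_exp] at h1 ⊢
  simp only [WithLp.ofLp_smul, Matrix.mulVec_smul, smul_dotProduct, dotProduct_smul,
    smul_eq_mul] at h1
  have h2 : 0 ≤ ‖t‖ ^ 2 := sq_nonneg _
  have h3 := mul_le_mul_of_nonneg_left h1 h2
  field_simp at h3 ⊢
  linarith

theorem IsNondegGaussian.exists_charFunDecay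
    {μ : ProbabilityMeasure (EuclideanSpace ℝ (Fin d))} (hμ : IsNondegGaussian μ) :
    ∃ c > 0, CharFunDecay c (μ : Measure (EuclideanSpace ℝ (Fin d))) := by
  obtain ⟨a, V, hV, hμV⟩ := id hμ
  -- The sphere is empty when `d = 0`, and then any `c` works.
  rcases (Metric.sphere (0 : EuclideanSpace ℝ (Fin d)) 1).eq_empty_or_nonempty with he | hne
  · refine ⟨1, one_pos, hμ.charFunDecay_of_sphere fun u hu => ?_⟩
    exact absurd (mem_sphere_zero_iff_norm.2 hu) (by rw [he]; exact Set.notMem_empty u)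
  have hcont : Continuous fun t : EuclideanSpace ℝ (Fin d) => t.ofLp ⬝ᵥ V.mulVec t.ofLp := by
    fun_prop
  obtain ⟨u, hu, hmin⟩ := (isCompact_sphere (0 : EuclideanSpace ℝ (Fin d)) 1).exists_isMinOn hne
    hcont.continuousOn
  have hu0 : u.ofLp ≠ 0 := by
    intro h0
    have : u = 0 := by ext i; simp [h0]
    rw [mem_sphere_zero_iff_norm, this, norm_zero] at hu
    exact zero_ne_one hu
  have hpos := hV.dotProduct_mulVec_pos hu0
  rw [star_trivial] at hpos
  refine ⟨_, half_pos hpos, hμ.charFunDecay_of_sphere fun v hv => ?_⟩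
  rw [hμV, norm_charFun_multivariateGaussian hV, Real.exp_le_exp]
  have := hmin (mem_sphere_zero_iff_norm.2 hv)
  simp only [Set.mem_ofPred_eq] at this
  linarith

/-- The characteristic functions of a compact set of nondegenerate Gaussian measures have a common
Gaussian bound. -/
theorem HellingerCompact.exists_charFunDecay
    {𝒦 : Set (ProbabilityMeasure (EuclideanSpace ℝ (Fin d)))} (h𝒦 : HellingerCompact 𝒦)
    (hG : ∀ μ ∈ 𝒦, IsNondegGaussian μ) :
    ∃ c > 0, ∀ μ ∈ 𝒦, CharFunDecay c (μ : Measure (EuclideanSpace ℝ (Fin d))) := by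
  -- If no common `c` existed, some `μ n ∈ 𝒦` and unit vectors `u n` would have characteristic
  -- function moduli tending to `1`. A Hellinger limit `q ∈ 𝒦` has its own `c`. The vectors `u n`
  -- need not converge, because the characteristic functions approach that of `q` uniformly in their
  -- argument.
  by_contra! hcon
  have hex : ∀ n : ℕ, ∃ μ ∈ 𝒦, ∃ u : EuclideanSpace ℝ (Fin d), ‖u‖ = 1 ∧
      Real.exp (-(1 / ((n : ℝ) + 1))) < ‖charFun (μ : Measure (EuclideanSpace ℝ (Fin d))) u‖ := by
    intro n
    obtain ⟨μ, hμ, hd⟩ := hcon (1 / ((n : ℝ) + 1)) (by positivity)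
    refine ⟨μ, hμ, ?_⟩
    by_contra! hle
    exact hd ((hG μ hμ).charFunDecay_of_sphere hle)
  choose μ hμ u hu hlt using hex
  obtain ⟨q, hq, φ, hφ, hlim⟩ := h𝒦 μ hμ
  obtain ⟨c, hc, hdec⟩ := (hG q hq).exists_charFunDecay
  have hle : ∀ n, Real.exp (-(1 / ((φ n : ℝ) + 1))) ≤ Real.exp (-c) + 4 * hellinger
      (μ (φ n) : Measure (EuclideanSpace ℝ (Fin d))) (q : Measure (EuclideanSpace ℝ (Fin d))) := by
    intro n
    have h1 := norm_charFun_sub_le_hellinger (μ (φ n) : Measure (EuclideanSpace ℝ (Fin d)))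
      (q : Measure (EuclideanSpace ℝ (Fin d))) (u (φ n))
    have h2 := hdec (u (φ n))
    rw [hu, one_pow, mul_one] at h2
    have h3 := norm_sub_norm_le (charFun (μ (φ n) : Measure (EuclideanSpace ℝ (Fin d))) (u (φ n)))
      (charFun (q : Measure (EuclideanSpace ℝ (Fin d))) (u (φ n)))
    linarith [hlt (φ n)]
  have hl : Tendsto (fun n => Real.exp (-(1 / ((φ n : ℝ) + 1)))) atTop (𝓝 (Real.exp (-0))) :=
    (Real.continuous_exp.tendsto _).comp
      ((tendsto_one_div_add_atTop_nhds_zero_nat.comp hφ.tendsto_atTop).neg)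
  have hr := (hlim.const_mul 4).const_add (Real.exp (-c))
  have := le_of_tendsto_of_tendsto' hl hr hle
  rw [neg_zero, Real.exp_zero, mul_zero, add_zero] at this
  have h1 : Real.exp (-c) < 1 := by rw [Real.exp_lt_one_iff]; linarith
  linarith

end Euclidean

end CharFunDecay

/-! ### Weights and normalization of clusters. -/

section Cluster

variable {E : Type*} [MeasurableSpace E] {K : ℕ}

theorem cluster_subset (Ω : MixMeas E) (α : ProbabilityMeasure E → Fin K) (k : Fin K) :
    cluster Ω α k ⊆ Ω.atoms := Finset.filter_subset _ _

theorem MixMeas.wt_pos {Ω : MixMeas E} {q : ProbabilityMeasure E} (hq : q ∈ Ω.atoms) :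
    0 < Ω.wt q := (Ω.nonneg q).lt_of_ne' (Finsupp.mem_support_iff.1 hq)

theorem MixMeas.sum_atoms (Ω : MixMeas E) : ∑ q ∈ Ω.atoms, Ω.wt q = 1 := Ω.sum_eq_one

theorem clusterWeight_nonneg (Ω : MixMeas E) (α : ProbabilityMeasure E → Fin K) (k : Fin K) :
    0 ≤ clusterWeight Ω α k := Finset.sum_nonneg fun q _ => Ω.nonneg q

theorem cluster_nonempty_of_clusterWeight_pos {Ω : MixMeas E} {α : ProbabilityMeasure E → Fin K}
    {k : Fin K} (h : 0 < clusterWeight Ω α k) : (cluster Ω α k).Nonempty := by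
  rw [Finset.nonempty_iff_ne_empty]
  intro he
  simp [clusterWeight, he] at h

theorem isProbabilityMeasure_clusterMeasure {Ω : MixMeas E} {α : ProbabilityMeasure E → Fin K}
    {k : Fin K} (h : 0 < clusterWeight Ω α k) :
    IsProbabilityMeasure (clusterMeasure Ω α k) := by
  refine ⟨?_⟩
  simp only [clusterMeasure, Measure.smul_apply, Measure.finsetSum_apply, smul_eq_mul,
    measure_univ, mul_one]
  rw [← ENNReal.ofReal_sum_of_nonneg fun q _ => Ω.nonneg q,
    ← ENNReal.ofReal_mul (inv_nonneg.2 h.le)]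
  change ENNReal.ofReal ((clusterWeight Ω α k)⁻¹ * clusterWeight Ω α k) = 1
  rw [inv_mul_cancel₀ h.ne', ENNReal.ofReal_one]

end Cluster

/-! ### Couplings and Wasserstein convergence. -/

section Coupling

variable {E : Type*} [MeasurableSpace E]

/-- `σ` is a coupling of the weights of two mixing measures. -/
structure IsCoupling (Ω Ω' : MixMeas E) (σ : ProbabilityMeasure E → ProbabilityMeasure E → ℝ) :
    Prop where
  nonneg : ∀ p ∈ Ω.atoms, ∀ q ∈ Ω'.atoms, 0 ≤ σ p q
  sum_right : ∀ p ∈ Ω.atoms, ∑ q ∈ Ω'.atoms, σ p q = Ω.wt p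
  sum_left : ∀ q ∈ Ω'.atoms, ∑ p ∈ Ω.atoms, σ p q = Ω'.wt q

/-- The mass that a coupling moves over a distance of at least `δ`. -/
noncomputable def farMass (Ω Ω' : MixMeas E)
    (σ : ProbabilityMeasure E → ProbabilityMeasure E → ℝ) (δ : ℝ) : ℝ :=
  ∑ p ∈ Ω.atoms, ∑ q ∈ Ω'.atoms,
    if δ ≤ hellinger (p : Measure E) (q : Measure E) then σ p q else 0

theorem exists_coupling_of_wasserstein_lt {r : ℝ} (hr : 1 ≤ r) {Ω Ω' : MixMeas E} {ε : ℝ}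
    (h : wasserstein r Ω Ω' < ε) : ∃ σ, IsCoupling Ω Ω' σ ∧
      ∑ p ∈ Ω.atoms, ∑ q ∈ Ω'.atoms, σ p q * hellinger (p : Measure E) (q : Measure E) ^ r <
        ε ^ r := by
  have hr0 : 0 < r := one_pos.trans_le hr
  obtain ⟨c, ⟨σ, h1, h2, h3, rfl⟩, hc⟩ := exists_lt_of_csInf_lt (by
    refine ⟨_, fun p q => Ω.wt p * Ω'.wt q, fun p _ q _ => mul_nonneg (Ω.nonneg p) (Ω'.nonneg q),
      fun p _ => ?_, fun q _ => ?_, rfl⟩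
    · rw [← Finset.mul_sum, Ω'.sum_atoms, mul_one]
    · rw [← Finset.sum_mul, Ω.sum_atoms, one_mul]) h
  refine ⟨σ, ⟨h1, h2, h3⟩, ?_⟩
  have h0 : 0 ≤ ∑ p ∈ Ω.atoms, ∑ q ∈ Ω'.atoms,
      σ p q * hellinger (p : Measure E) (q : Measure E) ^ r :=
    Finset.sum_nonneg fun p hp => Finset.sum_nonneg fun q hq =>
      mul_nonneg (h1 p hp q hq) (Real.rpow_nonneg (hellinger_nonneg _ _) r)
  have := Real.rpow_lt_rpow (Real.rpow_nonneg h0 _) hc hr0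
  rwa [← Real.rpow_mul h0, one_div, inv_mul_cancel₀ hr0.ne', Real.rpow_one] at this

/-- Markov's inequality for the transport cost. -/
theorem IsCoupling.farMass_mul_le {Ω Ω' : MixMeas E}
    {σ : ProbabilityMeasure E → ProbabilityMeasure E → ℝ} (hσ : IsCoupling Ω Ω' σ) {r δ : ℝ}
    (hr : 0 ≤ r) (hδ : 0 ≤ δ) : farMass Ω Ω' σ δ * δ ^ r ≤
      ∑ p ∈ Ω.atoms, ∑ q ∈ Ω'.atoms, σ p q * hellinger (p : Measure E) (q : Measure E) ^ r := by
  rw [farMass, Finset.sum_mul]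
  refine Finset.sum_le_sum fun p hp => ?_
  rw [Finset.sum_mul]
  refine Finset.sum_le_sum fun q hq => ?_
  split_ifs with h
  · exact mul_le_mul_of_nonneg_left (Real.rpow_le_rpow hδ h hr) (hσ.nonneg p hp q hq)
  · rw [zero_mul]
    exact mul_nonneg (hσ.nonneg p hp q hq) (Real.rpow_nonneg (hellinger_nonneg _ _) r)

theorem eventually_exists_coupling {ι : Type*} {l : Filter ι} {r : ℝ} (hr : 1 ≤ r)
    {Ω' : ι → MixMeas E} {Ω : MixMeas E}
    (h : Tendsto (fun i => wasserstein r (Ω' i) Ω) l (𝓝 0)) {δ κ : ℝ} (hδ : 0 < δ) (hκ : 0 < κ) :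
    ∀ᶠ i in l, ∃ σ, IsCoupling (Ω' i) Ω σ ∧ farMass (Ω' i) Ω σ δ < κ := by
  have hr0 : 0 < r := one_pos.trans_le hr
  -- The `r`-th power of this threshold is `δ ^ r * κ`, exactly what Markov's inequality needs to
  -- give far mass below `κ`.
  have hε : 0 < δ * κ ^ r⁻¹ := by positivity
  filter_upwards [h.eventually_lt_const hε] with i hi
  obtain ⟨σ, hσ, hlt⟩ := exists_coupling_of_wasserstein_lt hr hi
  refine ⟨σ, hσ, ?_⟩
  have h1 := (hσ.farMass_mul_le hr0.le hδ.le).trans_lt hlt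
  rw [Real.mul_rpow hδ.le (by positivity), ← Real.rpow_mul hκ.le, inv_mul_cancel₀ hr0.ne',
    Real.rpow_one, mul_comm (δ ^ r)] at h1
  exact lt_of_mul_lt_mul_right h1 (by positivity)

theorem IsCoupling.sum_sum {Ω Ω' : MixMeas E}
    {σ : ProbabilityMeasure E → ProbabilityMeasure E → ℝ} (hσ : IsCoupling Ω Ω' σ) :
    ∑ p ∈ Ω.atoms, ∑ q ∈ Ω'.atoms, σ p q = 1 := by
  rw [Finset.sum_congr rfl hσ.sum_right, Ω.sum_atoms]

/-- Both cluster sums become integrals against the same coupling. Pairs closer than `δ` have equal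
labels and contribute at most `ε` times their mass; any other pair contributes at most `2M` times
its mass. -/
theorem IsCoupling.abs_sum_cluster_sub_le {K : ℕ} {Ω Ω' : MixMeas E}
    {σ : ProbabilityMeasure E → ProbabilityMeasure E → ℝ} (hσ : IsCoupling Ω Ω' σ)
    {α α' : ProbabilityMeasure E → Fin K} {g : ProbabilityMeasure E → ℝ} {M ε δ : ℝ}
    (hM : ∀ p ∈ Ω.atoms, |g p| ≤ M) (hM' : ∀ q ∈ Ω'.atoms, |g q| ≤ M) (hε : 0 ≤ ε)
    (hnear : ∀ p ∈ Ω.atoms, ∀ q ∈ Ω'.atoms, hellinger (p : Measure E) (q : Measure E) < δ →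
      α p = α' q ∧ |g p - g q| ≤ ε) (k : Fin K) :
    |∑ p ∈ cluster Ω α k, Ω.wt p * g p - ∑ q ∈ cluster Ω' α' k, Ω'.wt q * g q| ≤
      ε + 2 * M * farMass Ω Ω' σ δ := by
  have h1 : ∑ p ∈ cluster Ω α k, Ω.wt p * g p =
      ∑ p ∈ Ω.atoms, ∑ q ∈ Ω'.atoms, σ p q * if α p = k then g p else 0 := by
    rw [cluster, Finset.sum_filter]
    refine Finset.sum_congr rfl fun p hp => ?_
    rw [← Finset.sum_mul, hσ.sum_right p hp, mul_ite, mul_zero]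
  have h2 : ∑ q ∈ cluster Ω' α' k, Ω'.wt q * g q =
      ∑ p ∈ Ω.atoms, ∑ q ∈ Ω'.atoms, σ p q * if α' q = k then g q else 0 := by
    rw [cluster, Finset.sum_filter, Finset.sum_comm]
    refine Finset.sum_congr rfl fun q hq => ?_
    rw [← Finset.sum_mul, hσ.sum_left q hq, mul_ite, mul_zero]
  have hterm : ∀ p ∈ Ω.atoms, ∀ q ∈ Ω'.atoms,
      |(σ p q * if α p = k then g p else 0) - σ p q * if α' q = k then g q else 0| ≤
        ε * σ p q + 2 * M *
          if δ ≤ hellinger (p : Measure E) (q : Measure E) then σ p q else 0 := by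
    intro p hp q hq
    have h0 := hσ.nonneg p hp q hq
    rw [← mul_sub, abs_mul, abs_of_nonneg h0]
    have hM0 : 0 ≤ M := (abs_nonneg _).trans (hM p hp)
    by_cases hfar : δ ≤ hellinger (p : Measure E) (q : Measure E)
    · have hX : |if α p = k then g p else 0| ≤ M := by
        split_ifs
        · exact hM p hp
        · simpa using hM0
      have hY : |if α' q = k then g q else 0| ≤ M := by
        split_ifs
        · exact hM' q hq
        · simpa using hM0
      rw [if_pos hfar]
      have hXY := (abs_sub _ _).trans (add_le_add hX hY)
      have h3 := mul_le_mul_of_nonneg_left hXY h0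
      have h4 := mul_nonneg hε h0
      linarith
    · obtain ⟨hl, hg⟩ := hnear p hp q hq (not_le.1 hfar)
      rw [if_neg hfar, hl, mul_zero, add_zero, mul_comm ε]
      refine mul_le_mul_of_nonneg_left ?_ h0
      split_ifs
      · exact hg
      · simpa using hε
  rw [h1, h2, ← Finset.sum_sub_distrib]
  refine (Finset.abs_sum_le_sum_abs _ _).trans ?_
  calc _ ≤ ∑ p ∈ Ω.atoms, ∑ q ∈ Ω'.atoms, (ε * σ p q + 2 * M *
          if δ ≤ hellinger (p : Measure E) (q : Measure E) then σ p q else 0) := by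
        refine Finset.sum_le_sum fun p hp => ?_
        rw [← Finset.sum_sub_distrib]
        exact (Finset.abs_sum_le_sum_abs _ _).trans (Finset.sum_le_sum fun q hq => hterm p hp q hq)
    _ = _ := by
        simp only [Finset.sum_add_distrib, ← Finset.mul_sum]
        rw [hσ.sum_sum, mul_one, farMass]

/-- Every atom of the limit of a Wasserstein convergent sequence is near to an atom of the
approximations. -/
theorem eventually_exists_near_atom {ι : Type*} {l : Filter ι} {r : ℝ} (hr : 1 ≤ r)
    {Ω' : ι → MixMeas E} {Ω : MixMeas E}
    (h : Tendsto (fun i => wasserstein r (Ω' i) Ω) l (𝓝 0)) {δ : ℝ} (hδ : 0 < δ) :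
    ∀ᶠ i in l, ∀ q ∈ Ω.atoms, ∃ p ∈ (Ω' i).atoms,
      hellinger (p : Measure E) (q : Measure E) < δ := by
  rw [Filter.eventually_all_finset]
  intro q hq
  -- The far mass is made smaller than the weight of `q`. If every atom of the approximation were
  -- far from `q`, that whole weight would be far mass.
  filter_upwards [eventually_exists_coupling hr h hδ (MixMeas.wt_pos hq)] with i ⟨σ, hσ, hlt⟩
  by_contra! hfar
  refine hlt.not_ge ?_
  rw [← hσ.sum_left q hq, farMass]
  refine Finset.sum_le_sum fun p hp => ?_
  have := Finset.single_le_sum (f := fun q' : ProbabilityMeasure E =>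
    if δ ≤ hellinger (p : Measure E) (q' : Measure E) then σ p q' else 0) (fun q' hq' => by
      have := hσ.nonneg p hp q' hq'
      split_ifs <;> simp [this]) hq
  simpa only [if_pos (hfar p hp)] using this

end Coupling

/-! ### Uniform limits of weighted cluster densities. -/

section Limits

variable {d K : ℕ}

/-- Valid for weight zero as well, since then every summand has weight zero. Thus empty clusters
need no separate treatment. -/
theorem clusterWeight_mul_clusterDensity (Ω : MixMeas (EuclideanSpace ℝ (Fin d)))
    (α : ProbabilityMeasure (EuclideanSpace ℝ (Fin d)) → Fin K) (k : Fin K)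
    (x : EuclideanSpace ℝ (Fin d)) : clusterWeight Ω α k * clusterDensity Ω α k x =
      ∑ q ∈ cluster Ω α k, Ω.wt q *
        contDensity (q : Measure (EuclideanSpace ℝ (Fin d))) x := by
  rcases (clusterWeight_nonneg Ω α k).eq_or_lt with h | h
  · rw [← h, zero_mul]
    have h' := (Finset.sum_eq_zero_iff_of_nonneg fun q _ => Ω.nonneg q).1 h.symm
    exact (Finset.sum_eq_zero fun q hq => by rw [h' q hq, zero_mul]).symm
  · rw [clusterDensity, ← mul_assoc, mul_inv_cancel₀ h.ne', one_mul]

theorem charFun_clusterMeasure (Ω : MixMeas (EuclideanSpace ℝ (Fin d)))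
    (α : ProbabilityMeasure (EuclideanSpace ℝ (Fin d)) → Fin K) (k : Fin K)
    (t : EuclideanSpace ℝ (Fin d)) : charFun (clusterMeasure Ω α k) t =
      ∑ q ∈ cluster Ω α k, (((clusterWeight Ω α k)⁻¹ * Ω.wt q : ℝ) : ℂ) *
        charFun (q : Measure (EuclideanSpace ℝ (Fin d))) t := by
  have hi : ∀ q ∈ cluster Ω α k, Integrable
      (fun x : EuclideanSpace ℝ (Fin d) => Complex.exp (inner ℝ x t * Complex.I))
      (ENNReal.ofReal (Ω.wt q) • (q : Measure (EuclideanSpace ℝ (Fin d)))) := by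
    intro q _
    refine Integrable.smul_measure ?_ ENNReal.ofReal_ne_top
    refine (integrable_const (1 : ℝ)).mono' (Continuous.aestronglyMeasurable (by fun_prop))
      (ae_of_all _ fun x => (Complex.norm_exp_ofReal_mul_I _).le)
  rw [charFun_apply, clusterMeasure, integral_smul_measure, integral_finsetSum_measure hi,
    ENNReal.toReal_ofReal (inv_nonneg.2 (clusterWeight_nonneg Ω α k)), Finset.smul_sum]
  refine Finset.sum_congr rfl fun q _ => ?_
  rw [integral_smul_measure, ENNReal.toReal_ofReal (Ω.nonneg q), smul_smul, charFun_apply,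
    Complex.real_smul]

theorem charFunDecay_clusterMeasure {c : ℝ} {Ω : MixMeas (EuclideanSpace ℝ (Fin d))}
    (h : ∀ q ∈ Ω.atoms, CharFunDecay c (q : Measure (EuclideanSpace ℝ (Fin d))))
    {α : ProbabilityMeasure (EuclideanSpace ℝ (Fin d)) → Fin K} {k : Fin K}
    (hw : 0 < clusterWeight Ω α k) : CharFunDecay c (clusterMeasure Ω α k) := by
  intro t
  rw [charFun_clusterMeasure]
  refine (norm_sum_le _ _).trans ?_
  calc _ ≤ ∑ q ∈ cluster Ω α k, (clusterWeight Ω α k)⁻¹ * Ω.wt q * Real.exp (-c * ‖t‖ ^ 2) := by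
        refine Finset.sum_le_sum fun q hq => ?_
        have h0 : 0 ≤ (clusterWeight Ω α k)⁻¹ * Ω.wt q :=
          mul_nonneg (inv_nonneg.2 hw.le) (Ω.nonneg q)
        rw [norm_mul, Complex.norm_real, Real.norm_of_nonneg h0]
        exact mul_le_mul_of_nonneg_left (h q (cluster_subset Ω α k hq) t) h0
    _ = _ := by
        rw [← Finset.sum_mul, ← Finset.mul_sum]
        change (clusterWeight Ω α k)⁻¹ * clusterWeight Ω α k * _ = _
        rw [inv_mul_cancel₀ hw.ne', one_mul]

theorem clusterDensity_eq_inversionIntegral {c : ℝ} (hc : 0 < c)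
    {Ω : MixMeas (EuclideanSpace ℝ (Fin d))}
    (h : ∀ q ∈ Ω.atoms, CharFunDecay c (q : Measure (EuclideanSpace ℝ (Fin d))))
    (α : ProbabilityMeasure (EuclideanSpace ℝ (Fin d)) → Fin K) (k : Fin K)
    (x : EuclideanSpace ℝ (Fin d)) :
    clusterDensity Ω α k x = (inversionIntegral (charFun (clusterMeasure Ω α k)) x).re := by
  have h1 : charFun (clusterMeasure Ω α k) = fun t =>
      ∑ q ∈ cluster Ω α k, (((clusterWeight Ω α k)⁻¹ * Ω.wt q : ℝ) : ℂ) *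
        charFun (q : Measure (EuclideanSpace ℝ (Fin d))) t :=
    funext (charFun_clusterMeasure Ω α k)
  rw [h1, inversionIntegral_sum _ _ _ fun q hq => integrable_of_norm_le_exp measurable_charFun hc
    (h q (cluster_subset Ω α k hq)), Complex.re_sum, clusterDensity, Finset.mul_sum]
  refine Finset.sum_congr rfl fun q hq => ?_
  rw [Complex.re_ofReal_mul, (h q (cluster_subset Ω α k hq)).contDensity_eq hc, mul_assoc]

theorem abs_contDensity_le {c : ℝ} (hc : 0 < c) {μ : Measure (EuclideanSpace ℝ (Fin d))}
    [IsFiniteMeasure μ] (h : CharFunDecay c μ) (x : EuclideanSpace ℝ (Fin d)) :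
    |contDensity μ x| ≤
      ∫ t : EuclideanSpace ℝ (Fin d), Real.exp (-c * ‖-(2 * Real.pi) • t‖ ^ 2) := by
  rw [h.contDensity_eq hc]
  exact (Complex.abs_re_le_norm _).trans
    (norm_inversionIntegral_le_of_le_exp measurable_charFun hc h x)

theorem exists_delta_contDensity {c : ℝ} (hc : 0 < c)
    {q : ProbabilityMeasure (EuclideanSpace ℝ (Fin d))}
    (hq : CharFunDecay c (q : Measure (EuclideanSpace ℝ (Fin d)))) {ε : ℝ} (hε : 0 < ε) :
    ∃ δ > 0, ∀ p : ProbabilityMeasure (EuclideanSpace ℝ (Fin d)),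
      CharFunDecay c (p : Measure (EuclideanSpace ℝ (Fin d))) →
      hellinger (p : Measure (EuclideanSpace ℝ (Fin d)))
        (q : Measure (EuclideanSpace ℝ (Fin d))) < δ →
      ∀ x, |contDensity (p : Measure (EuclideanSpace ℝ (Fin d))) x -
        contDensity (q : Measure (EuclideanSpace ℝ (Fin d))) x| ≤ ε := by
  set h : ProbabilityMeasure (EuclideanSpace ℝ (Fin d)) → ℝ := fun p =>
    hellinger (p : Measure (EuclideanSpace ℝ (Fin d)))
      (q : Measure (EuclideanSpace ℝ (Fin d))) with hh
  -- The filter of measures Hellinger-close to `q` that have the decay is countably generated, so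
  -- the dominated convergence lemma applies along it; its basis of balls then yields `δ`.
  have hl : Tendsto h (Filter.comap h (𝓝 0) ⊓
      𝓟 {p | CharFunDecay c (p : Measure (EuclideanSpace ℝ (Fin d)))}) (𝓝 0) :=
    tendsto_comap.mono_left inf_le_left
  have hdec : ∀ᶠ p : ProbabilityMeasure (EuclideanSpace ℝ (Fin d)) in Filter.comap h (𝓝 0) ⊓
      𝓟 {p | CharFunDecay c (p : Measure (EuclideanSpace ℝ (Fin d)))},
      CharFunDecay c (p : Measure (EuclideanSpace ℝ (Fin d))) :=
    Filter.mem_inf_of_right (mem_principal_self _)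
  have hev := eventually_norm_inversionIntegral_sub_le hc
    (Eventually.of_forall fun p => measurable_charFun) hdec measurable_charFun hq
    (tendsto_charFun_of_hellinger (Eventually.of_forall fun p => inferInstance) hl) hε
  rw [eventually_inf_principal] at hev
  obtain ⟨δ, hδ, hb⟩ := ((Metric.nhds_basis_ball.comap h).eventually_iff).1 hev
  refine ⟨δ, hδ, fun p hp hpq x => ?_⟩
  have hpb : p ∈ h ⁻¹' Metric.ball 0 δ := by
    simpa [hh, abs_of_nonneg (hellinger_nonneg _ _)] using hpq
  rw [hp.contDensity_eq hc, hq.contDensity_eq hc, ← Complex.sub_re]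
  exact (Complex.abs_re_le_norm _).trans (hb hpb hp x)

/-- The weighted cluster densities converge uniformly under Wasserstein convergence, for
assignments that follow those of the limit. -/
theorem eventually_abs_clusterDensity_sub_le {ι : Type*} {l : Filter ι} {r : ℝ} (hr : 1 ≤ r)
    {c : ℝ} (hc : 0 < c) {Ω' : ι → MixMeas (EuclideanSpace ℝ (Fin d))}
    {Ω : MixMeas (EuclideanSpace ℝ (Fin d))}
    (hΩ' : ∀ i, ∀ q ∈ (Ω' i).atoms, CharFunDecay c (q : Measure (EuclideanSpace ℝ (Fin d))))
    (hΩ : ∀ q ∈ Ω.atoms, CharFunDecay c (q : Measure (EuclideanSpace ℝ (Fin d))))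
    (h : Tendsto (fun i => wasserstein r (Ω' i) Ω) l (𝓝 0))
    {α' : ι → ProbabilityMeasure (EuclideanSpace ℝ (Fin d)) → Fin K}
    {α : ProbabilityMeasure (EuclideanSpace ℝ (Fin d)) → Fin K} {δ : ℝ} (hδ : 0 < δ)
    (hα : ∀ᶠ i in l, ∀ p ∈ (Ω' i).atoms, ∀ q ∈ Ω.atoms,
      hellinger (p : Measure (EuclideanSpace ℝ (Fin d)))
        (q : Measure (EuclideanSpace ℝ (Fin d))) < δ → α' i p = α q) {ε : ℝ} (hε : 0 < ε) :
    ∀ᶠ i in l, ∀ k x, |clusterWeight (Ω' i) (α' i) k * clusterDensity (Ω' i) (α' i) k x -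
      clusterWeight Ω α k * clusterDensity Ω α k x| ≤ ε := by
  choose! D hD0 hD using fun q hq => exists_delta_contDensity hc (hΩ q hq) (half_pos hε)
  obtain ⟨δ', hδ', hle, hleD⟩ : ∃ δ' > 0, δ' ≤ δ ∧ ∀ q ∈ Ω.atoms, δ' ≤ D q := by
    have hev : ∀ᶠ δ' in 𝓝[>] (0 : ℝ), δ' ≤ δ ∧ ∀ q ∈ Ω.atoms, δ' ≤ D q := by
      refine Filter.Eventually.and ?_ ((Filter.eventually_all_finset _).2 fun q hq => ?_)
      · exact nhdsWithin_le_nhds (Iic_mem_nhds hδ)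
      · exact nhdsWithin_le_nhds (Iic_mem_nhds (hD0 q hq))
    obtain ⟨δ', h1, h2⟩ := (hev.and self_mem_nhdsWithin).exists
    exact ⟨δ', h2, h1⟩
  set M := ∫ t : EuclideanSpace ℝ (Fin d), Real.exp (-c * ‖-(2 * Real.pi) • t‖ ^ 2) with hM
  have hM0 : 0 ≤ M := integral_nonneg fun t => (Real.exp_pos _).le
  -- Far mass below this value costs at most `ε / 2`; the `+ 1` avoids division by zero.
  have hκ : 0 < ε / 2 / (2 * M + 1) := by positivity
  filter_upwards [hα, eventually_exists_coupling hr h hδ' hκ] with i hi ⟨σ, hσ, hfar⟩ k x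
  rw [clusterWeight_mul_clusterDensity, clusterWeight_mul_clusterDensity]
  refine (hσ.abs_sum_cluster_sub_le
    (g := fun q => contDensity (q : Measure (EuclideanSpace ℝ (Fin d))) x)
    (fun p hp => abs_contDensity_le hc (hΩ' i p hp) x)
    (fun q hq => abs_contDensity_le hc (hΩ q hq) x) (half_pos hε).le (δ := δ')
    (fun p hp q hq hpq => ⟨hi p hp q hq (hpq.trans_le hle),
      hD q hq p (hΩ' i p hp) (hpq.trans_le (hleD q hq)) x⟩) k).trans ?_
  rw [lt_div_iff₀ (by positivity)] at hfar
  have h0 : 0 ≤ farMass (Ω' i) Ω σ δ' := by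
    refine Finset.sum_nonneg fun p hp => Finset.sum_nonneg fun q hq => ?_
    have := hσ.nonneg p hp q hq
    split_ifs <;> simp [this]
  rw [← hM]
  nlinarith

theorem Enumerates.wt_pos {E : Type*} [MeasurableSpace E] {γ : Fin K → ProbabilityMeasure E}
    {Λ : MixMeas E} (hγ : Enumerates γ Λ) (k : Fin K) : 0 < Λ.wt (γ k) :=
  MixMeas.wt_pos ((hγ.2 _).2 ⟨k, rfl⟩)

theorem RegularAlong.eventually_clusterWeight_pos {E : Type*} [MeasurableSpace E]
    {γ : Fin K → ProbabilityMeasure E} {Λ : MixMeas E} (hγ : Enumerates γ Λ) {Ω : ℕ → MixMeas E}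
    {α : ℕ → ProbabilityMeasure E → Fin K} (h : RegularAlong γ Λ Ω α) (k : Fin K) :
    ∀ᶠ L in atTop, 0 < clusterWeight (Ω L) (α L) k :=
  (h k).2.eventually_const_lt (hγ.wt_pos k)

/-- Each `γ k` is a Hellinger limit of mixtures of measures with the decay, and the bound is closed
under mixing and under pointwise limits of characteristic functions. -/
theorem RegularAlong.charFunDecay {c : ℝ}
    {γ : Fin K → ProbabilityMeasure (EuclideanSpace ℝ (Fin d))}
    {Λ : MixMeas (EuclideanSpace ℝ (Fin d))} (hγ : Enumerates γ Λ)
    {Ω : ℕ → MixMeas (EuclideanSpace ℝ (Fin d))}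
    {α : ℕ → ProbabilityMeasure (EuclideanSpace ℝ (Fin d)) → Fin K}
    (h : RegularAlong γ Λ Ω α) (hΩ : ∀ᶠ L in atTop, ∀ q ∈ (Ω L).atoms,
      CharFunDecay c (q : Measure (EuclideanSpace ℝ (Fin d)))) (k : Fin K) :
    CharFunDecay c (γ k : Measure (EuclideanSpace ℝ (Fin d))) := by
  have hpos := h.eventually_clusterWeight_pos hγ k
  refine CharFunDecay.of_tendsto (l := atTop) (μ := fun L => clusterMeasure (Ω L) (α L) k) ?_
    (tendsto_charFun_of_hellinger
      (hpos.mono fun L hL => isProbabilityMeasure_clusterMeasure hL) (h k).1)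
  filter_upwards [hpos, hΩ] with L h1 h2
  exact charFunDecay_clusterMeasure h2 h1

/-- Uniform convergence of the weighted cluster densities along a regular assignment sequence. -/
theorem RegularAlong.eventually_abs_clusterDensity_sub_le {c : ℝ} (hc : 0 < c)
    {γ : Fin K → ProbabilityMeasure (EuclideanSpace ℝ (Fin d))}
    {Λ : MixMeas (EuclideanSpace ℝ (Fin d))} (hγ : Enumerates γ Λ)
    {Ω : ℕ → MixMeas (EuclideanSpace ℝ (Fin d))}
    {α : ℕ → ProbabilityMeasure (EuclideanSpace ℝ (Fin d)) → Fin K}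
    (h : RegularAlong γ Λ Ω α) (hΩ : ∀ᶠ L in atTop, ∀ q ∈ (Ω L).atoms,
      CharFunDecay c (q : Measure (EuclideanSpace ℝ (Fin d)))) {ε : ℝ} (hε : 0 < ε) :
    ∀ᶠ L in atTop, ∀ k x, |clusterWeight (Ω L) (α L) k * clusterDensity (Ω L) (α L) k x -
      Λ.wt (γ k) * contDensity (γ k : Measure (EuclideanSpace ℝ (Fin d))) x| ≤ ε := by
  rw [Filter.eventually_all]
  intro k
  have hpos := h.eventually_clusterWeight_pos hγ k
  have hdec := h.charFunDecay hγ hΩ k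
  set M := ∫ t : EuclideanSpace ℝ (Fin d), Real.exp (-c * ‖-(2 * Real.pi) • t‖ ^ 2) with hM
  have hM0 : 0 ≤ M := integral_nonneg fun t => (Real.exp_pos _).le
  set w := Λ.wt (γ k) with hw
  have hw0 : 0 < w := hγ.wt_pos k
  have hbd : ∀ᶠ L in atTop, clusterWeight (Ω L) (α L) k ≤ w + 1 :=
    ((h k).2.eventually_lt_const (by linarith)).mono fun _ h => h.le
  have hδ : 0 < ε / 2 / (M + 1) := by positivity
  have hwlim := Metric.tendsto_nhds.1 (h k).2 _ hδ
  have hev := eventually_norm_inversionIntegral_sub_le hc (l := atTop)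
    (φ := fun L => charFun (clusterMeasure (Ω L) (α L) k))
    (hpos.mono fun L hL => by
      have := isProbabilityMeasure_clusterMeasure hL
      exact measurable_charFun)
    ((hpos.and hΩ).mono fun L hL => charFunDecay_clusterMeasure hL.2 hL.1)
    measurable_charFun hdec
    (tendsto_charFun_of_hellinger
      (hpos.mono fun L hL => isProbabilityMeasure_clusterMeasure hL) (h k).1)
    (show 0 < ε / 2 / (w + 1) by positivity)
  filter_upwards [hpos, hbd, hwlim, hev, hΩ] with L h0 h1 h2 h3 h4 x
  have e1 : |clusterDensity (Ω L) (α L) k x -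
      contDensity (γ k : Measure (EuclideanSpace ℝ (Fin d))) x| ≤ ε / 2 / (w + 1) := by
    rw [clusterDensity_eq_inversionIntegral hc h4, hdec.contDensity_eq hc, ← Complex.sub_re]
    exact (Complex.abs_re_le_norm _).trans (h3 x)
  have e2 := abs_contDensity_le hc hdec x
  rw [Real.dist_eq] at h2
  rw [← hM] at e2
  -- The weight factor is at most `w + 1` and the limit density at most `M`, so each of the two
  -- errors is at most `ε / 2`.
  have e3 : ∀ a b f g : ℝ, a * f - b * g = a * (f - g) + (a - b) * g := fun a b f g => by ring
  rw [e3]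
  refine (abs_add_le _ _).trans ?_
  rw [abs_mul, abs_mul, abs_of_pos h0]
  have e4 := mul_le_mul h1 e1 (abs_nonneg _) (by positivity)
  have e5 := mul_le_mul h2.le e2 (abs_nonneg _) hδ.le
  have e6 : (w + 1) * (ε / 2 / (w + 1)) = ε / 2 := by field_simp
  have e7 : ε / 2 / (M + 1) * M ≤ ε / 2 := by
    rw [div_mul_eq_mul_div, div_le_iff₀ (by positivity)]
    nlinarith
  linarith

end Limits

/-! ### Single-linkage clustering and nearest labelling. -/

section SingleLinkage

variable {E : Type*} [MeasurableSpace E] {K : ℕ}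

/-- Raising the height only merges clusters. This induces a surjection of labels, which is a
bijection because both cuts have `K` labels. -/
theorem IsSingleLinkageCut.exists_perm_of_le {s : Finset (ProbabilityMeasure E)} {h h' : ℝ}
    {α β : ProbabilityMeasure E → Fin K} (hα : IsSingleLinkageCut s h α)
    (hβ : IsSingleLinkageCut s h' β) (hh : h ≤ h') :
    ∃ σ : Equiv.Perm (Fin K), ∀ p ∈ s, σ (α p) = β p := by
  choose rep hrep hαrep using hα.1
  have himp : ∀ p ∈ s, ∀ q ∈ s, α p = α q → β p = β q := fun p hp q hq hpq =>
    (hβ.2 p hp q hq).2 (Relation.ReflTransGen.mono (fun a b ⟨ha, hb, hab⟩ =>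
      ⟨ha, hb, hab.trans hh⟩) _ _ ((hα.2 p hp q hq).1 hpq))
  have hF : ∀ p ∈ s, β (rep (α p)) = β p := fun p hp => himp _ (hrep _) _ hp (hαrep _)
  have hsurj : Function.Surjective fun k => β (rep k) := fun k => by
    obtain ⟨p, hp, rfl⟩ := hβ.1 k
    exact ⟨α p, hF p hp⟩
  exact ⟨Equiv.ofBijective _ (Finite.surjective_iff_bijective.1 hsurj), hF⟩

/-- Two cuts of a single-linkage dendrogram with the same number of clusters agree up to a
permutation of the labels. -/
theorem IsSingleLinkageCut.exists_perm {s : Finset (ProbabilityMeasure E)} {h h' : ℝ}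
    {α β : ProbabilityMeasure E → Fin K} (hα : IsSingleLinkageCut s h α)
    (hβ : IsSingleLinkageCut s h' β) :
    ∃ σ : Equiv.Perm (Fin K), ∀ p ∈ s, σ (α p) = β p := by
  rcases le_total h h' with hh | hh
  · exact hα.exists_perm_of_le hβ hh
  · obtain ⟨σ, hσ⟩ := hβ.exists_perm_of_le hα hh
    exact ⟨σ.symm, fun p hp => by rw [← hσ p hp, Equiv.symm_apply_apply]⟩

/-- A perturbation of well separated clusters is recovered by a cut of the single-linkage
dendrogram. -/
theorem isSingleLinkageCut_of_perturbation {A B : Finset (ProbabilityMeasure E)}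
    {α : ProbabilityMeasure E → Fin K} {η δ : ℝ} (hsurj : ∀ k, ∃ q ∈ A, α q = k)
    (hintra : ∀ q ∈ A, ∀ q' ∈ A, α q = α q' →
      hellinger (q : Measure E) (q' : Measure E) ≤ η)
    (hinter : ∀ q ∈ A, ∀ q' ∈ A, α q ≠ α q' →
      η + 4 * δ < hellinger (q : Measure E) (q' : Measure E))
    (hAB : ∀ q ∈ A, ∃ p ∈ B, hellinger (p : Measure E) (q : Measure E) < δ)
    {m : ProbabilityMeasure E → ProbabilityMeasure E} (hm : ∀ p ∈ B, m p ∈ A ∧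
      hellinger (p : Measure E) (m p : Measure E) < δ) :
    IsSingleLinkageCut B (η + 2 * δ) (fun p => α (m p)) ∧
      ∀ p ∈ B, ∀ q ∈ A, hellinger (p : Measure E) (q : Measure E) < δ → α (m p) = α q := by
  have hfollow : ∀ p ∈ B, ∀ q ∈ A, hellinger (p : Measure E) (q : Measure E) < δ →
      α (m p) = α q := by
    intro p hp q hq hpq
    by_contra hne
    have h1 := hinter _ (hm p hp).1 q hq hne
    have h2 := hellinger_triangle (m p : Measure E) (p : Measure E) (q : Measure E)
    rw [hellinger_comm (m p : Measure E) (p : Measure E)] at h2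
    -- Comparing `q` with itself shows `0 ≤ η`.
    have h3 := hintra q hq q hq rfl
    rw [hellinger_self] at h3
    linarith [(hm p hp).2, hellinger_nonneg (p : Measure E) (q : Measure E)]
  refine ⟨⟨fun k => ?_, fun p hp q hq => ⟨fun heq => ?_, fun hchain => ?_⟩⟩, hfollow⟩
  · obtain ⟨q, hq, rfl⟩ := hsurj k
    obtain ⟨p, hp, hpq⟩ := hAB q hq
    exact ⟨p, hp, hfollow p hp q hq hpq⟩
  · refine Relation.ReflTransGen.single ⟨hp, hq, ?_⟩
    have h1 := hintra _ (hm p hp).1 _ (hm q hq).1 heq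
    have h2 := hellinger_triangle (p : Measure E) (m p : Measure E) (q : Measure E)
    have h3 := hellinger_triangle (m p : Measure E) (m q : Measure E) (q : Measure E)
    rw [hellinger_comm (m q : Measure E) (q : Measure E)] at h3
    linarith [(hm p hp).2, (hm q hq).2]
  -- No step of a chain changes cluster: a step of length at most `η + 2δ` joins points whose
  -- matched atoms are less than `η + 4δ` apart.
  · induction hchain with
    | refl => rfl
    | tail _ hstep ih =>
      obtain ⟨hb, hc, hbc⟩ := hstep
      refine (ih hb).trans ?_
      by_contra hne
      rename_i b c _
      have h1 := hinter _ (hm b hb).1 _ (hm c hc).1 hne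
      have h2 := hellinger_triangle (m b : Measure E) (b : Measure E) (m c : Measure E)
      have h3 := hellinger_triangle (b : Measure E) (c : Measure E) (m c : Measure E)
      rw [hellinger_comm (m b : Measure E) (b : Measure E)] at h2
      linarith [(hm b hb).2, (hm c hc).2]

/-- If every point of `A` is near to a point of `B`, the points of `A` are far apart and `B` is not
larger than `A`, then every point of `B` is near to a point of `A`. -/
theorem exists_near_of_card_le {A B : Finset (ProbabilityMeasure E)} {δ : ℝ}
    (hAB : ∀ q ∈ A, ∃ p ∈ B, hellinger (p : Measure E) (q : Measure E) < δ)
    (hsep : ∀ q ∈ A, ∀ q' ∈ A, q ≠ q' → 2 * δ ≤ hellinger (q : Measure E) (q' : Measure E))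
    (hcard : B.card ≤ A.card) :
    ∀ p ∈ B, ∃ q ∈ A, hellinger (p : Measure E) (q : Measure E) < δ := by
  intro p hp
  have : Nonempty (ProbabilityMeasure E) := ⟨p⟩
  choose! f hfB hf using hAB
  -- Two points of `A` sharing a partner would be within `2δ`. Injectivity and the cardinality bound
  -- then leave no point of `B` without a partner.
  have hinj : Set.InjOn f (A : Set (ProbabilityMeasure E)) := by
    intro q hq q' hq' heq
    by_contra hne
    have h1 := hsep q hq q' hq' hne
    have h2 := hellinger_triangle (q : Measure E) (f q : Measure E) (q' : Measure E)
    rw [hellinger_comm (q : Measure E) (f q : Measure E)] at h2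
    have h3 := hf q' hq'
    rw [← heq] at h3
    linarith [hf q hq]
  have himg : A.image f = B := by
    refine Finset.eq_of_subset_of_card_le (Finset.image_subset_iff.2 hfB) ?_
    rwa [Finset.card_image_of_injOn hinj]
  rw [← himg] at hp
  obtain ⟨q, hq, rfl⟩ := Finset.mem_image.1 hp
  exact ⟨q, hq, hf q hq⟩

/-- A nearest atom other than `q` would also lie within `δ` of `p`, contradicting the `2δ`
separation. -/
theorem IsNearestLabelling.eq_of_hellinger_lt {Ω Ω' : MixMeas E}
    {α α' : ProbabilityMeasure E → Fin K} (h : IsNearestLabelling Ω α Ω' α') {δ : ℝ}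
    (hsep : ∀ q ∈ Ω.atoms, ∀ q' ∈ Ω.atoms, q ≠ q' →
      2 * δ ≤ hellinger (q : Measure E) (q' : Measure E))
    {p q : ProbabilityMeasure E} (hp : p ∈ Ω'.atoms) (hq : q ∈ Ω.atoms)
    (hpq : hellinger (p : Measure E) (q : Measure E) < δ) : α' p = α q := by
  obtain ⟨q', hq', hmin, hα⟩ := h p hp
  rw [hα]
  by_contra hne
  have h1 := hsep q' hq' q hq fun heq => hne (by rw [heq])
  have h2 := hellinger_triangle (q' : Measure E) (p : Measure E) (q : Measure E)
  rw [hellinger_comm (q' : Measure E) (p : Measure E)] at h2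
  linarith [hmin q hq]

/-- The mixing measure concentrated at `q`. -/
noncomputable def MixMeas.dirac (q : ProbabilityMeasure E) : MixMeas E where
  wt := Finsupp.single q 1
  nonneg p := by
    rw [Finsupp.single_apply]
    split_ifs <;> norm_num
  sum_eq_one := by simp

theorem MixMeas.atoms_dirac (q : ProbabilityMeasure E) : (MixMeas.dirac q).atoms = {q} := by
  simp [MixMeas.atoms, MixMeas.dirac]

theorem MixMeas.mix_dirac (q : ProbabilityMeasure E) : (MixMeas.dirac q).mix = q := by
  rw [MixMeas.mix, MixMeas.atoms_dirac]
  simp [MixMeas.dirac]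

/-- Places the cluster component in the convex hull of its atoms, so that `hellingerDiam` bounds its
distance to each of them. -/
theorem exists_mix_eq_clusterMeasure {Ω : MixMeas E} {α : ProbabilityMeasure E → Fin K} {k : Fin K}
    (h : 0 < clusterWeight Ω α k) :
    ∃ Ω' : MixMeas E, Ω'.atoms ⊆ cluster Ω α k ∧ Ω'.mix = clusterMeasure Ω α k := by
  set wt : ProbabilityMeasure E →₀ ℝ := Finsupp.onFinset (cluster Ω α k)
    (fun q => if q ∈ cluster Ω α k then (clusterWeight Ω α k)⁻¹ * Ω.wt q else 0)
    (fun q hq => by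
      by_contra hn
      exact hq (if_neg hn)) with hwt
  have hap : ∀ q ∈ cluster Ω α k, wt q = (clusterWeight Ω α k)⁻¹ * Ω.wt q := fun q hq => by
    rw [hwt, Finsupp.onFinset_apply, if_pos hq]
  have hsupp : wt.support = cluster Ω α k := by
    refine Finset.Subset.antisymm Finsupp.support_onFinset_subset fun q hq => ?_
    rw [Finsupp.mem_support_iff, hap q hq]
    exact mul_ne_zero (inv_ne_zero h.ne')
      (MixMeas.wt_pos (cluster_subset Ω α k hq)).ne'
  refine ⟨⟨wt, fun q => ?_, ?_⟩, ?_, ?_⟩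
  · rw [hwt, Finsupp.onFinset_apply]
    split_ifs
    · exact mul_nonneg (inv_nonneg.2 h.le) (Ω.nonneg q)
    · exact le_rfl
  · rw [hsupp, Finset.sum_congr rfl hap, ← Finset.mul_sum]
    exact inv_mul_cancel₀ h.ne'
  · exact hsupp.subset
  · simp only [MixMeas.mix, MixMeas.atoms, clusterMeasure]
    rw [hsupp, Finset.smul_sum]
    refine Finset.sum_congr rfl fun q hq => ?_
    rw [hap q hq, ENNReal.ofReal_mul (inv_nonneg.2 h.le), smul_smul]

theorem isProbabilityMeasure_mix (Ω : MixMeas E) : IsProbabilityMeasure Ω.mix := by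
  refine ⟨?_⟩
  simp only [MixMeas.mix, Measure.finsetSum_apply, Measure.smul_apply, smul_eq_mul,
    measure_univ, mul_one]
  rw [← ENNReal.ofReal_sum_of_nonneg fun q _ => Ω.nonneg q, Ω.sum_atoms, ENNReal.ofReal_one]

theorem hellinger_mix_le_one (Ω Ω' : MixMeas E) : hellinger Ω.mix Ω'.mix ≤ 1 := by
  have := isProbabilityMeasure_mix Ω
  have := isProbabilityMeasure_mix Ω'
  exact hellinger_le_one _ _

theorem hellinger_mix_le_hellingerDiam {s : Finset (ProbabilityMeasure E)} {Ω Ω' : MixMeas E}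
    (h : Ω.atoms ⊆ s) (h' : Ω'.atoms ⊆ s) : hellinger Ω.mix Ω'.mix ≤ hellingerDiam s := by
  refine le_csSup ⟨1, ?_⟩ ⟨Ω, Ω', h, h', rfl⟩
  rintro _ ⟨Ω₁, Ω₂, _, _, rfl⟩
  exact hellinger_mix_le_one Ω₁ Ω₂

theorem hellingerDiam_le_one (s : Finset (ProbabilityMeasure E)) : hellingerDiam s ≤ 1 := by
  refine Real.sSup_le ?_ one_pos.le
  rintro _ ⟨Ω₁, Ω₂, _, _, rfl⟩
  exact hellinger_mix_le_one Ω₁ Ω₂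

theorem hellingerDiam_add_hellinger_le_etaWidth (γ : Fin K → ProbabilityMeasure E) (Ω : MixMeas E)
    (α : ProbabilityMeasure E → Fin K) (k l : Fin K) :
    hellingerDiam (cluster Ω α k) + hellinger (γ l : Measure E) (clusterMeasure Ω α l) ≤
      etaWidth γ Ω α :=
  add_le_add (le_ciSup (f := fun k => hellingerDiam (cluster Ω α k)) (Set.finite_range _).bddAbove k)
    (le_ciSup (f := fun k => hellinger (γ k : Measure E) (clusterMeasure Ω α k))
      (Set.finite_range _).bddAbove l)

theorem hellinger_le_etaWidth_of_eq (γ : Fin K → ProbabilityMeasure E) {Ω : MixMeas E}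
    {α : ProbabilityMeasure E → Fin K} {q q' : ProbabilityMeasure E} (hq : q ∈ Ω.atoms)
    (hq' : q' ∈ Ω.atoms) (h : α q = α q') :
    hellinger (q : Measure E) (q' : Measure E) ≤ etaWidth γ Ω α := by
  have h1 := hellinger_mix_le_hellingerDiam (s := cluster Ω α (α q)) (Ω := MixMeas.dirac q)
    (Ω' := MixMeas.dirac q') (by simp [MixMeas.atoms_dirac, cluster, hq])
    (by simp [MixMeas.atoms_dirac, cluster, hq', h])
  rw [MixMeas.mix_dirac, MixMeas.mix_dirac] at h1
  have h2 := hellingerDiam_add_hellinger_le_etaWidth γ Ω α (α q) (α q)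
  linarith [hellinger_nonneg (γ (α q) : Measure E) (clusterMeasure Ω α (α q))]

theorem hellinger_atom_le_etaWidth (γ : Fin K → ProbabilityMeasure E) {Ω : MixMeas E}
    {α : ProbabilityMeasure E → Fin K} {q : ProbabilityMeasure E} (hq : q ∈ Ω.atoms)
    (h : 0 < clusterWeight Ω α (α q)) :
    hellinger (γ (α q) : Measure E) (q : Measure E) ≤ etaWidth γ Ω α := by
  obtain ⟨Ω', hs, hmix⟩ := exists_mix_eq_clusterMeasure h
  have h1 := hellinger_mix_le_hellingerDiam (s := cluster Ω α (α q)) hs (Ω' := MixMeas.dirac q)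
    (by simp [MixMeas.atoms_dirac, cluster, hq])
  rw [MixMeas.mix_dirac, hmix] at h1
  have := isProbabilityMeasure_clusterMeasure h
  have h2 := hellinger_triangle (γ (α q) : Measure E) (clusterMeasure Ω α (α q)) (q : Measure E)
  linarith [hellingerDiam_add_hellinger_le_etaWidth γ Ω α (α q) (α q)]

/-- Along the regular assignment sequence of a well separated mixing measure, the clusters are
eventually farther apart than their width. -/
theorem WellSeparated.eventually_lt_hellinger {γ : Fin K → ProbabilityMeasure E} {Λ : MixMeas E}
    (hγ : Enumerates γ Λ) {Ω : ℕ → MixMeas E} (h : WellSeparated γ Λ Ω) :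
    ∃ α : ℕ → ProbabilityMeasure E → Fin K, RegularAlong γ Λ Ω α ∧
      ∀ᶠ L in atTop, ∀ q ∈ (Ω L).atoms, ∀ q' ∈ (Ω L).atoms, α L q ≠ α L q' →
        etaWidth γ (Ω L) (α L) < hellinger (q : Measure E) (q' : Measure E) := by
  obtain ⟨ξ, hξ, α, hreg, hsep⟩ := h
  refine ⟨α, hreg, ?_⟩
  have hpos : ∀ᶠ L in atTop, ∀ k, 0 < clusterWeight (Ω L) (α L) k :=
    Filter.eventually_all.2 fun k => hreg.eventually_clusterWeight_pos hγ k
  have hbdd : IsBoundedUnder (· ≤ ·) atTop fun L => etaWidth γ (Ω L) (α L) := by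
    refine ⟨1 + 1, ?_⟩
    -- Boundedness makes the real `limsup` meaningful. The bound `1 + 1` holds once the cluster
    -- components are probability measures.
    rw [eventually_map]
    filter_upwards [hpos] with L hL
    refine add_le_add (Real.iSup_le (fun k => hellingerDiam_le_one _) one_pos.le)
      (Real.iSup_le (fun k => ?_) one_pos.le)
    have := isProbabilityMeasure_clusterMeasure (hL k)
    exact hellinger_le_one _ _
  -- Passing from `γ i`, `γ j` to atoms of their clusters costs one width each, so a factor `3`
  -- leaves a gap of one width.
  have hev : ∀ᶠ L in atTop, ∀ i j, i ≠ j →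
      3 * etaWidth γ (Ω L) (α L) < hellinger (γ i : Measure E) (γ j : Measure E) := by
    refine Filter.eventually_all.2 fun i => Filter.eventually_all.2 fun j => ?_
    by_cases hij : i = j
    · exact Eventually.of_forall fun L hne => absurd hij hne
    have h1 := hsep i j hij
    have h2 : limsup (fun L => etaWidth γ (Ω L) (α L)) atTop <
        hellinger (γ i : Measure E) (γ j : Measure E) / 3 := by
      rw [lt_div_iff₀ (by norm_num)]
      rcases le_or_gt 0 (limsup (fun L => etaWidth γ (Ω L) (α L)) atTop) with h0 | h0
      · nlinarith
      · linarith [hellinger_nonneg (γ i : Measure E) (γ j : Measure E)]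
    filter_upwards [eventually_lt_of_limsup_lt h2 hbdd] with L hL _
    linarith
  filter_upwards [hpos, hev] with L h0 h1 q hq q' hq' hne
  have h2 := h1 _ _ hne
  have h3 := hellinger_atom_le_etaWidth γ hq (h0 _)
  have h4 := hellinger_atom_le_etaWidth γ hq' (h0 _)
  have h5 := hellinger_triangle (γ (α L q) : Measure E) (q : Measure E) (γ (α L q') : Measure E)
  have h6 := hellinger_triangle (q : Measure E) (q' : Measure E) (γ (α L q') : Measure E)
  rw [hellinger_comm (q' : Measure E) (γ (α L q') : Measure E)] at h6
  linarith

end SingleLinkage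

/-! ### Classifiers, exceptional sets and thresholds. -/

section Partition

/-- The best admissible error at each `n` tends to zero; `1 / (n + 1)` is added because the infimum
need not be attained and the error must be positive. -/
theorem exists_tendsto_zero_of_eventually {P : ℕ → ℝ → Prop}
    (hmono : ∀ n a b, a ≤ b → P n a → P n b) (h : ∀ ε > 0, ∀ᶠ n in atTop, P n ε) :
    ∃ v : ℕ → ℝ, (∀ n, 0 < v n) ∧ Tendsto v atTop (𝓝 0) ∧ ∀ᶠ n in atTop, P n (v n) := by
  have hpos : ∀ n : ℕ, (0 : ℝ) < 1 / ((n : ℝ) + 1) := fun n => by positivity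
  have hbdd : ∀ n, BddBelow {ε : ℝ | 0 < ε ∧ P n ε} := fun n => ⟨0, fun ε hε => hε.1.le⟩
  have h0 : ∀ n, 0 ≤ sInf {ε : ℝ | 0 < ε ∧ P n ε} := fun n => Real.sInf_nonneg fun ε hε => hε.1.le
  refine ⟨fun n => sInf {ε : ℝ | 0 < ε ∧ P n ε} + 1 / ((n : ℝ) + 1),
    fun n => add_pos_of_nonneg_of_pos (h0 n) (hpos n), ?_, ?_⟩
  · suffices hs : Tendsto (fun n => sInf {ε : ℝ | 0 < ε ∧ P n ε}) atTop (𝓝 0) by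
      simpa using hs.add tendsto_one_div_add_atTop_nhds_zero_nat
    refine tendsto_order.2 ⟨fun a ha => Eventually.of_forall fun n => ha.trans_le (h0 n),
      fun a ha => ?_⟩
    filter_upwards [h (a / 2) (half_pos ha)] with n hn
    exact (csInf_le (hbdd n) ⟨half_pos ha, hn⟩).trans_lt (half_lt_self ha)
  · filter_upwards [h 1 one_pos] with n hn
    obtain ⟨ε, hε, hlt⟩ := exists_lt_of_csInf_lt (s := {ε : ℝ | 0 < ε ∧ P n ε})
      ⟨1, one_pos, hn⟩ (lt_add_of_pos_right _ (hpos n))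
    exact hmono n _ _ hlt.le hε.2

variable {d K : ℕ}

theorem measurableSet_exceptional {X : Set (EuclideanSpace ℝ (Fin d))} {w : Fin K → ℝ}
    {f : Fin K → EuclideanSpace ℝ (Fin d) → ℝ} (hf : ∀ k, Continuous (f k)) (t : ℝ) :
    MeasurableSet (exceptional X w f t) := by
  have : exceptional X w f t =
      ⋃ i, ⋃ j, {x : X | i ≠ j ∧ |w i * f i x - w j * f j x| ≤ t} := by
    ext x
    simp [exceptional]
  rw [this]
  refine MeasurableSet.iUnion fun i => MeasurableSet.iUnion fun j => ?_
  have hi := hf i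
  have hj := hf j
  have hm : Measurable fun x : X => |w i * f i x - w j * f j x| :=
    Continuous.measurable (by fun_prop)
  exact (MeasurableSet.const (i ≠ j)).inter (measurableSet_le hm measurable_const)

theorem exceptional_mono {X : Set (EuclideanSpace ℝ (Fin d))} {w : Fin K → ℝ}
    {f : Fin K → EuclideanSpace ℝ (Fin d) → ℝ} {s t : ℝ} (h : s ≤ t) :
    exceptional X w f s ⊆ exceptional X w f t :=
  fun _ ⟨i, j, hij, hx⟩ => ⟨i, j, hij, hx.trans h⟩

/-- There are only finitely many pairs, so gaps all larger than `a` are all larger than some `t >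
a`. -/
theorem iInter_exceptional (X : Set (EuclideanSpace ℝ (Fin d))) (w : Fin K → ℝ)
    (f : Fin K → EuclideanSpace ℝ (Fin d) → ℝ) (a : ℝ) :
    ⋂ t > a, exceptional X w f t = exceptional X w f a := by
  refine Set.Subset.antisymm (fun x hx => ?_)
    (Set.subset_iInter₂ fun t ht => exceptional_mono (le_of_lt ht))
  by_contra hn
  have hn' : ∀ i j, i ≠ j → a < |w i * f i x - w j * f j x| := fun i j hij => by
    by_contra hle
    exact hn ⟨i, j, hij, not_lt.1 hle⟩
  have hev : ∀ᶠ t in 𝓝[>] a, ∀ i j, i ≠ j → t < |w i * f i x - w j * f j x| := by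
    refine Filter.eventually_all.2 fun i => Filter.eventually_all.2 fun j => ?_
    by_cases hij : i = j
    · exact Eventually.of_forall fun _ hne => absurd hij hne
    · filter_upwards [nhdsWithin_le_nhds (Iio_mem_nhds (hn' i j hij))] with t ht _ using ht
  obtain ⟨t, h1, h2⟩ := (hev.and self_mem_nhdsWithin).exists
  obtain ⟨i, j, hij, hle⟩ := Set.mem_iInter₂.1 hx t h2
  exact (h1 i j hij).not_ge hle

theorem tendsto_measure_exceptional {X : Set (EuclideanSpace ℝ (Fin d))} {υ : Measure X}
    {w : Fin K → ℝ} {f : Fin K → EuclideanSpace ℝ (Fin d) → ℝ} (hf : ∀ k, Continuous (f k))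
    {a τ : ℝ} (haτ : a < τ) (hτ : υ (exceptional X w f τ) ≠ ∞) {s : ℕ → ℝ}
    (hs : Tendsto s atTop (𝓝 a)) (hsa : ∀ᶠ n in atTop, a ≤ s n) :
    Tendsto (fun n => υ (exceptional X w f (s n))) atTop (𝓝 (υ (exceptional X w f a))) := by
  have h := tendsto_measure_biInter_gt (μ := υ) (s := exceptional X w f) (a := a)
    (fun t _ => (measurableSet_exceptional hf t).nullMeasurableSet)
    (fun i j _ hij => exceptional_mono hij) ⟨τ, haτ, hτ⟩
  rw [iInter_exceptional] at h
  have h' : ContinuousWithinAt (fun t => υ (exceptional X w f t)) (Set.Ici a) a := by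
    rw [← Set.Ioi_insert, continuousWithinAt_insert_self]
    exact h
  exact h'.tendsto.comp (tendsto_nhdsWithin_iff.2 ⟨hs, hsa⟩)

/-- Consistency of the partitions from uniform convergence of the weighted densities. -/
theorem partitionConsistent_of_uniform {X : Set (EuclideanSpace ℝ (Fin d))} {υ : Measure X}
    {w : Fin K → ℝ} {f : Fin K → EuclideanSpace ℝ (Fin d) → ℝ} (hf : ∀ k, Continuous (f k))
    {M : ℝ} (hM : ∀ k x, |w k * f k x| ≤ M)
    {Ω' : ℕ → ℕ → MixMeas (EuclideanSpace ℝ (Fin d))}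
    {α' : ℕ → ℕ → ProbabilityMeasure (EuclideanSpace ℝ (Fin d)) → Fin K}
    {a : ℕ → Fin K → EuclideanSpace ℝ (Fin d) → ℝ}
    (h1 : ∀ ε > 0, ∀ᶠ L in atTop, ∀ k x, |a L k x - w k * f k x| ≤ ε)
    (h2 : ∀ᶠ L in atTop, ∀ ε > 0, ∀ᶠ n in atTop, ∀ k x,
      |clusterWeight (Ω' L n) (α' L n) k * clusterDensity (Ω' L n) (α' L n) k x - a L k x| ≤ ε) :
    PartitionConsistent X υ w f Ω' α' := by
  obtain ⟨v, hv0, hv, hvP⟩ := exists_tendsto_zero_of_eventually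
    (P := fun L ε => ∀ k x, |a L k x - w k * f k x| ≤ ε)
    (fun L _ _ hab h k x => (h k x).trans hab) h1
  have hu : ∀ L, ∃ u : ℕ → ℝ, (∀ n, 0 < u n) ∧ Tendsto u atTop (𝓝 0) ∧
      ((∀ ε > 0, ∀ᶠ n in atTop, ∀ k x, |clusterWeight (Ω' L n) (α' L n) k *
        clusterDensity (Ω' L n) (α' L n) k x - a L k x| ≤ ε) →
      ∀ᶠ n in atTop, ∀ k x, |clusterWeight (Ω' L n) (α' L n) k *
        clusterDensity (Ω' L n) (α' L n) k x - a L k x| ≤ u n) := by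
    intro L
    by_cases hL : ∀ ε > 0, ∀ᶠ n in atTop, ∀ k x, |clusterWeight (Ω' L n) (α' L n) k *
        clusterDensity (Ω' L n) (α' L n) k x - a L k x| ≤ ε
    · obtain ⟨u, hu0, hu, huP⟩ := exists_tendsto_zero_of_eventually
        (P := fun n ε => ∀ k x, |clusterWeight (Ω' L n) (α' L n) k *
          clusterDensity (Ω' L n) (α' L n) k x - a L k x| ≤ ε)
        (fun n _ _ hab h k x => (h k x).trans hab) hL
      exact ⟨u, hu0, hu, fun _ => huP⟩
    · exact ⟨fun n => 1 / ((n : ℝ) + 1), fun n => by positivity,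
        tendsto_one_div_add_atTop_nhds_zero_nat, fun h => absurd h hL⟩
  choose u hu0 hu huP using hu
  set good : ℕ → ℕ → Prop := fun L n => ∀ k x, |clusterWeight (Ω' L n) (α' L n) k *
    clusterDensity (Ω' L n) (α' L n) k x - w k * f k x| ≤ v L + u L n with hgood
  have hgoodev : ∀ᶠ L in atTop, ∀ᶠ n in atTop, good L n := by
    filter_upwards [hvP, h2] with L hL1 hL2
    filter_upwards [huP L hL2] with n hn k x
    have := abs_sub_le (clusterWeight (Ω' L n) (α' L n) k * clusterDensity (Ω' L n) (α' L n) k x)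
      (a L k x) (w k * f k x)
    linarith [hn k x, hL1 k x]
  -- The factor `2` arises because both competing weighted densities may be off. The fallback
  -- exceeds every difference of weighted densities of `Λ`, so the inclusion holds for all `L` and
  -- `n`.
  set t : ℕ → ℕ → ℝ := fun L n => if good L n then 2 * (v L + u L n) else 2 * |M| + 1 with ht
  have htev : ∀ᶠ L in atTop, ∀ᶠ n in atTop, t L n = 2 * (v L + u L n) :=
    hgoodev.mono fun L hL => hL.mono fun n hn => if_pos hn
  have htlim : ∀ᶠ L in atTop, Tendsto (t L) atTop (𝓝 (2 * v L)) := by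
    filter_upwards [htev] with L hL
    refine Tendsto.congr' (hL.mono fun n hn => hn.symm) ?_
    simpa using ((hu L).const_add (v L)).const_mul 2
  have hv2 : Tendsto (fun L => 2 * v L) atTop (𝓝 0) := by simpa using hv.const_mul 2
  have hdiff : ∀ (L n : ℕ) (c c' : X → Fin K), IsBayesClassifier X w f c →
      IsBayesClassifier X (clusterWeight (Ω' L n) (α' L n)) (clusterDensity (Ω' L n) (α' L n)) c' →
      ∀ x, c' x ≠ c x → x ∈ exceptional X w f (t L n) := by
    intro L n c c' hc hc' x hne
    refine ⟨c x, c' x, hne.symm, ?_⟩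
    rw [abs_of_nonneg (sub_nonneg.2 (hc x (c' x)))]
    by_cases hg : good L n
    · have e1 := abs_le.1 (hg (c x) x)
      have e2 := abs_le.1 (hg (c' x) x)
      have e3 := hc' x (c x)
      simp only [ht, if_pos hg]
      linarith [e1.1, e2.2]
    · simp only [ht, if_neg hg]
      have e1 := abs_le.1 (hM (c x) x)
      have e2 := abs_le.1 (hM (c' x) x)
      linarith [e1.2, e2.1, le_abs_self M]
  refine ⟨t, fun L n => ?_, ⟨_, htlim, hv2⟩, fun L n c c' hc hc' => ⟨fun x hx => ?_, ?_⟩, ?_⟩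
  · simp only [ht]
    have := hv0 L
    have := hu0 L n
    split_ifs <;> positivity
  · by_contra hne
    exact hx (hdiff L n c c' hc hc' x hne)
  · refine measure_mono fun x hx => ?_
    obtain ⟨k, hk⟩ := Set.mem_iUnion.1 hx
    refine hdiff L n c c' hc hc' x fun heq => ?_
    simp [Set.mem_symmDiff, heq] at hk
  · rintro ⟨τ, hτ0, hτ⟩
    -- Since `t L n ≥ 2 * v L` eventually, the inner limit is approached from the right, where
    -- continuity from above applies as soon as `2 * v L < τ`.
    refine ⟨fun L => υ (exceptional X w f (2 * v L)), ?_, ?_⟩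
    · filter_upwards [htev, htlim, hv2.eventually_lt_const hτ0] with L hL1 hL2 hL3
      refine tendsto_measure_exceptional hf hL3 hτ hL2 ?_
      filter_upwards [hL1] with n hn
      rw [hn]
      linarith [hu0 L n]
    · exact tendsto_measure_exceptional hf hτ0 hτ hv2
        (Eventually.of_forall fun L => by linarith [hv0 L])

end Partition

/-! ### Matching labels and assembling the consistency theorem. -/

section Consistency

variable {d K : ℕ}

/-- At Hellinger distance zero the characteristic functions coincide, and they determine the
measure. -/
theorem hellinger_pos_of_ne {p q : ProbabilityMeasure (EuclideanSpace ℝ (Fin d))} (h : p ≠ q) :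
    0 < hellinger (p : Measure (EuclideanSpace ℝ (Fin d)))
      (q : Measure (EuclideanSpace ℝ (Fin d))) := by
  refine (hellinger_nonneg _ _).lt_of_ne' fun h0 => h ?_
  have heq : (p : Measure (EuclideanSpace ℝ (Fin d))) = q := by
    refine Measure.ext_of_charFun (funext fun t => ?_)
    have := norm_charFun_sub_le_hellinger (p : Measure (EuclideanSpace ℝ (Fin d)))
      (q : Measure (EuclideanSpace ℝ (Fin d))) t
    rw [h0, mul_zero] at this
    exact sub_eq_zero.1 (norm_le_zero_iff.1 this)
  exact Subtype.ext heq

theorem eventually_le_hellinger (A : Finset (ProbabilityMeasure (EuclideanSpace ℝ (Fin d)))) :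
    ∀ᶠ δ in 𝓝[>] (0 : ℝ), ∀ q ∈ A, ∀ q' ∈ A, q ≠ q' →
      2 * δ ≤ hellinger (q : Measure (EuclideanSpace ℝ (Fin d)))
        (q' : Measure (EuclideanSpace ℝ (Fin d))) := by
  refine (Filter.eventually_all_finset _).2 fun q _ => (Filter.eventually_all_finset _).2
    fun q' _ => ?_
  by_cases hne : q = q'
  · exact Eventually.of_forall fun _ h => absurd hne h
  · have h0 := half_pos (hellinger_pos_of_ne hne)
    filter_upwards [nhdsWithin_le_nhds (Iic_mem_nhds h0)] with δ hδ _
    simp only [Set.mem_Iic] at hδ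
    linarith

theorem RegularAlong.perm {E : Type*} [MeasurableSpace E] {γ γ' : Fin K → ProbabilityMeasure E}
    {Λ : MixMeas E} {Ω : ℕ → MixMeas E} {α : ℕ → ProbabilityMeasure E → Fin K}
    (h : RegularAlong γ' Λ Ω α) {σ : Equiv.Perm (Fin K)} (hσ : ∀ k, γ (σ k) = γ' k) :
    RegularAlong γ Λ Ω fun L q => σ (α L q) := by
  intro k
  have hcl : ∀ L, cluster (Ω L) (fun q => σ (α L q)) k = cluster (Ω L) (α L) (σ.symm k) := fun L =>
    Finset.filter_congr fun q _ => by rw [Equiv.eq_symm_apply]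
  have := h (σ.symm k)
  rw [← hσ, Equiv.apply_symm_apply] at this
  simpa only [clusterMeasure, clusterWeight, hcl] using this

theorem Enumerates.exists_perm {E : Type*} [MeasurableSpace E]
    {γ γ' : Fin K → ProbabilityMeasure E} {Λ : MixMeas E} (h : Enumerates γ Λ)
    (h' : Enumerates γ' Λ) : ∃ σ : Equiv.Perm (Fin K), ∀ k, γ (σ k) = γ' k := by
  choose s hs using fun k => (h.2 (γ' k)).1 ((h'.2 _).2 ⟨k, rfl⟩)
  have hinj : Function.Injective s := fun k l hkl => h'.1 (by rw [← hs, ← hs, hkl])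
  exact ⟨Equiv.ofBijective s (Finite.injective_iff_bijective.1 hinj), hs⟩

/-- Consistency of the partitions for Wasserstein consistent mixing measures and assignments that
follow a regular assignment sequence. -/
theorem partitionConsistent_of_follows {r : ℝ} (hr : 1 ≤ r) {c : ℝ} (hc : 0 < c)
    {X : Set (EuclideanSpace ℝ (Fin d))} {υ : Measure X}
    {γ : Fin K → ProbabilityMeasure (EuclideanSpace ℝ (Fin d))}
    {Λ : MixMeas (EuclideanSpace ℝ (Fin d))} (hγ : Enumerates γ Λ)
    {Ω : ℕ → MixMeas (EuclideanSpace ℝ (Fin d))}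
    {α : ℕ → ProbabilityMeasure (EuclideanSpace ℝ (Fin d)) → Fin K}
    (hreg : RegularAlong γ Λ Ω α) (hΩ : ∀ᶠ L in atTop, ∀ q ∈ (Ω L).atoms,
      CharFunDecay c (q : Measure (EuclideanSpace ℝ (Fin d))))
    {Ω' : ℕ → ℕ → MixMeas (EuclideanSpace ℝ (Fin d))}
    {α' : ℕ → ℕ → ProbabilityMeasure (EuclideanSpace ℝ (Fin d)) → Fin K}
    (hΩ' : ∀ᶠ L in atTop, ∀ n, ∀ q ∈ (Ω' L n).atoms,
      CharFunDecay c (q : Measure (EuclideanSpace ℝ (Fin d))))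
    (hW : ∀ᶠ L in atTop, Tendsto (fun n => wasserstein r (Ω' L n) (Ω L)) atTop (𝓝 0))
    (hα : ∀ᶠ L in atTop, ∃ δ > 0, ∀ᶠ n in atTop, ∀ p ∈ (Ω' L n).atoms, ∀ q ∈ (Ω L).atoms,
      hellinger (p : Measure (EuclideanSpace ℝ (Fin d)))
        (q : Measure (EuclideanSpace ℝ (Fin d))) < δ → α' L n p = α L q) :
    PartitionConsistent X υ (fun k => Λ.wt (γ k))
      (fun k => contDensity (γ k : Measure (EuclideanSpace ℝ (Fin d)))) Ω' α' := by
  have hdec := hreg.charFunDecay hγ hΩ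
  refine partitionConsistent_of_uniform
    (M := ∫ t : EuclideanSpace ℝ (Fin d), Real.exp (-c * ‖-(2 * Real.pi) • t‖ ^ 2))
    (a := fun L k x => clusterWeight (Ω L) (α L) k * clusterDensity (Ω L) (α L) k x)
    (fun k => ?_) (fun k x => ?_)
    (fun ε hε => hreg.eventually_abs_clusterDensity_sub_le hc hγ hΩ hε) ?_
  · have h := (hdec k).isContDensity hc
    rw [h.contDensity_eq]
    exact h.1
  · have h1 : Λ.wt (γ k) ≤ 1 := by
      rw [← Λ.sum_atoms]
      exact Finset.single_le_sum (f := fun q => Λ.wt q) (fun q _ => Λ.nonneg q)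
        ((hγ.2 _).2 ⟨k, rfl⟩)
    rw [abs_mul, abs_of_pos (hγ.wt_pos k)]
    exact (mul_le_of_le_one_left (abs_nonneg _) h1).trans (abs_contDensity_le hc (hdec k) x)
  · filter_upwards [hΩ, hΩ', hW, hα] with L h1 h2 h3 ⟨δ, hδ, h4⟩ ε hε
    exact eventually_abs_clusterDensity_sub_le hr hc h2 h1 h3 hδ h4 hε

/-- Single-linkage clustering of the atoms of Wasserstein convergent mixing measures recovers a well
separated clustering of the limit, up to permutations of the labels. -/
theorem eventually_exists_perm_singleLinkage {r : ℝ} (hr : 1 ≤ r)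
    {Ω : MixMeas (EuclideanSpace ℝ (Fin d))} {Ω' : ℕ → MixMeas (EuclideanSpace ℝ (Fin d))}
    (hW : Tendsto (fun n => wasserstein r (Ω' n) Ω) atTop (𝓝 0))
    (hcard : ∀ᶠ n in atTop, (Ω' n).atoms.card = Ω.atoms.card)
    {α' : ℕ → ProbabilityMeasure (EuclideanSpace ℝ (Fin d)) → Fin K}
    (hα' : ∀ᶠ n in atTop, IsSingleLinkage (Ω' n).atoms (α' n))
    {α : ProbabilityMeasure (EuclideanSpace ℝ (Fin d)) → Fin K} {η : ℝ}
    (hsurj : ∀ k, ∃ q ∈ Ω.atoms, α q = k)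
    (hintra : ∀ q ∈ Ω.atoms, ∀ q' ∈ Ω.atoms, α q = α q' →
      hellinger (q : Measure (EuclideanSpace ℝ (Fin d)))
        (q' : Measure (EuclideanSpace ℝ (Fin d))) ≤ η)
    (hinter : ∀ q ∈ Ω.atoms, ∀ q' ∈ Ω.atoms, α q ≠ α q' →
      η < hellinger (q : Measure (EuclideanSpace ℝ (Fin d)))
        (q' : Measure (EuclideanSpace ℝ (Fin d)))) :
    ∃ δ > 0, ∀ᶠ n in atTop, ∃ σ : Equiv.Perm (Fin K), ∀ p ∈ (Ω' n).atoms, ∀ q ∈ Ω.atoms,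
      hellinger (p : Measure (EuclideanSpace ℝ (Fin d)))
        (q : Measure (EuclideanSpace ℝ (Fin d))) < δ → σ (α' n p) = α q := by
  have hev : ∀ᶠ δ in 𝓝[>] (0 : ℝ), ∀ q ∈ Ω.atoms, ∀ q' ∈ Ω.atoms, α q ≠ α q' →
      η + 4 * δ < hellinger (q : Measure (EuclideanSpace ℝ (Fin d)))
        (q' : Measure (EuclideanSpace ℝ (Fin d))) := by
    refine (Filter.eventually_all_finset _).2 fun q hq => (Filter.eventually_all_finset _).2
      fun q' hq' => ?_
    by_cases hne : α q = α q'
    · exact Eventually.of_forall fun _ h => absurd hne h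
    · have h0 := hinter q hq q' hq' hne
      have hc : Tendsto (fun δ : ℝ => η + 4 * δ) (𝓝 0) (𝓝 (η + 4 * 0)) :=
        Continuous.tendsto (by fun_prop) 0
      rw [mul_zero, add_zero] at hc
      filter_upwards [nhdsWithin_le_nhds (hc.eventually_lt_const h0)] with δ hδ _ using hδ
  obtain ⟨δ, ⟨h1, h2⟩, hδ⟩ :=
    ((hev.and (eventually_le_hellinger Ω.atoms)).and self_mem_nhdsWithin).exists
  refine ⟨δ, hδ, ?_⟩
  filter_upwards [hcard, hα', eventually_exists_near_atom hr hW hδ] with n h3 h4 h5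
  choose! m hm using exists_near_of_card_le h5 h2 h3.le
  obtain ⟨hcut, hfollow⟩ := isSingleLinkageCut_of_perturbation hsurj hintra h1 h5 hm
  -- The recovered clustering witnesses that a level with `K` clusters exists, which is what forces
  -- `α' n` to be a cut.
  obtain ⟨h, hcut'⟩ := h4 ⟨_, _, hcut⟩
  obtain ⟨σ, hσ⟩ := hcut'.exists_perm hcut
  exact ⟨σ, fun p hp q hq hpq => by rw [hσ p hp, hfollow p hp q hq hpq]⟩

theorem ae_eventually_of_eventually_ae {S : Type*} [MeasurableSpace S] {P : Measure S}
    {p : ℕ → S → Prop} (h : ∀ᶠ L in atTop, ∀ᵐ s ∂P, p L s) : ∀ᵐ s ∂P, ∀ᶠ L in atTop, p L s := by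
  obtain ⟨L₀, hL₀⟩ := eventually_atTop.1 h
  have h' : ∀ᵐ s ∂P, ∀ L, L₀ ≤ L → p L s := by
    rw [ae_all_iff]
    intro L
    by_cases hL : L₀ ≤ L
    · exact (hL₀ L hL).mono fun s hs _ => hs
    · exact ae_of_all _ fun s h => absurd h hL
  exact h'.mono fun s hs => eventually_atTop.2 ⟨L₀, hs⟩

end Consistency

end NPMix

theorem mainTheorem11 {d K : ℕ} (r : ℝ) (hr : 1 ≤ r)
    (X : Set (EuclideanSpace ℝ (Fin d))) (υ : MeasureTheory.Measure X)
    -- the base family: mixing measures over a compact family of Gaussian measures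
    (𝒦 : Set (MeasureTheory.ProbabilityMeasure (EuclideanSpace ℝ (Fin d))))
    (h𝒦 : NPMix.HellingerCompact 𝒦) (h𝒦G : ∀ μ ∈ 𝒦, NPMix.IsNondegGaussian μ)
    (𝔔 : Set (NPMix.MixMeas (EuclideanSpace ℝ (Fin d))))
    (h𝔔 : ∀ Ω ∈ 𝔔, ∀ q ∈ Ω.atoms, q ∈ 𝒦)
    -- the clusterable mixing measure, an enumeration of its atoms, and its projections
    (𝔏 : Set (NPMix.MixMeas (EuclideanSpace ℝ (Fin d))))
    (χ : ℕ → NPMix.MixMeas (EuclideanSpace ℝ (Fin d)) →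
      MeasureTheory.ProbabilityMeasure (EuclideanSpace ℝ (Fin d)) → Fin K)
    (hχ : NPMix.IsClusterable 𝔔 K 𝔏 χ)
    (Λ : NPMix.MixMeas (EuclideanSpace ℝ (Fin d))) (hΛ : Λ ∈ 𝔏)
    (γ : Fin K → MeasureTheory.ProbabilityMeasure (EuclideanSpace ℝ (Fin d)))
    (hγ : NPMix.Enumerates γ Λ)
    (Ω : ℕ → NPMix.MixMeas (EuclideanSpace ℝ (Fin d))) (hΩ : NPMix.IsProjSeq 𝔔 Λ.mix Ω)
    -- the i.i.d. sample and the Wasserstein consistent estimators of the projections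
    {S : Type*} [MeasurableSpace S] (P : MeasureTheory.Measure S)
    [MeasureTheory.IsProbabilityMeasure P]
    (Z : ℕ → S → EuclideanSpace ℝ (Fin d)) (hZm : ∀ i, Measurable (Z i))
    (hZ : ProbabilityTheory.iIndepFun Z P) (hZlaw : ∀ i, P.map (Z i) = Λ.mix)
    (est : ℕ → (n : ℕ) → (Fin n → EuclideanSpace ℝ (Fin d)) →
      NPMix.MixMeas (EuclideanSpace ℝ (Fin d)))
    (hest : ∀ᶠ L in atTop, ∀ n z, est L n z ∈ NPMix.level 𝔔 L)
    (hcons : ∀ᶠ L in atTop, ∀ᵐ s ∂P, Tendsto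
      (fun n => NPMix.wasserstein r (est L n (fun i : Fin n => Z i s)) (Ω L)) atTop (𝓝 0))
    -- the estimated assignments
    (αhat : ℕ → (n : ℕ) → (Fin n → EuclideanSpace ℝ (Fin d)) →
      MeasureTheory.ProbabilityMeasure (EuclideanSpace ℝ (Fin d)) → Fin K) :
    -- every component has a continuous density
    (∀ k, ∃ g, NPMix.IsContDensity (γ k : MeasureTheory.Measure (EuclideanSpace ℝ (Fin d))) g) ∧
    -- assignments that follow the cluster function
    ((∀ᶠ L in atTop, ∀ᵐ s ∂P, ∀ᶠ n in atTop,
        NPMix.IsNearestLabelling (Ω L) (χ L (Ω L)) (est L n (fun i : Fin n => Z i s))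
          (αhat L n (fun i : Fin n => Z i s))) →
      ∃ σ : Equiv.Perm (Fin K), ∀ᵐ s ∂P,
        NPMix.PartitionConsistent X υ (fun k => Λ.wt (γ k))
          (fun k => NPMix.contDensity (γ k : MeasureTheory.Measure (EuclideanSpace ℝ (Fin d))))
          (fun L n => est L n (fun i : Fin n => Z i s))
          (fun L n q => σ (αhat L n (fun i : Fin n => Z i s) q))) ∧
    -- assignments computed by single-linkage clustering
    (NPMix.WellSeparated γ Λ Ω →
      (∀ᶠ L in atTop, ∀ᵐ s ∂P, ∀ᶠ n in atTop,
        (est L n (fun i : Fin n => Z i s)).atoms.card = (Ω L).atoms.card) →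
      (∀ᶠ L in atTop, ∀ᵐ s ∂P, ∀ᶠ n in atTop,
        NPMix.IsSingleLinkage (est L n (fun i : Fin n => Z i s)).atoms
          (αhat L n (fun i : Fin n => Z i s))) →
      ∀ᵐ s ∂P, ∃ σ : ℕ → ℕ → Equiv.Perm (Fin K),
        NPMix.PartitionConsistent X υ (fun k => Λ.wt (γ k))
          (fun k => NPMix.contDensity (γ k : MeasureTheory.Measure (EuclideanSpace ℝ (Fin d))))
          (fun L n => est L n (fun i : Fin n => Z i s))
          (fun L n q => σ L n (αhat L n (fun i : Fin n => Z i s) q))) := by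
  obtain ⟨c, hc, hdec𝒦⟩ := h𝒦.exists_charFunDecay h𝒦G
  have hdecΩ : ∀ᶠ L in atTop, ∀ q ∈ (Ω L).atoms,
      NPMix.CharFunDecay c (q : Measure (EuclideanSpace ℝ (Fin d))) :=
    hΩ.mono fun L hL q hq => hdec𝒦 q (h𝔔 _ hL.1.1 q hq)
  have hdecest : ∀ᶠ L in atTop, ∀ n z, ∀ q ∈ (est L n z).atoms,
      NPMix.CharFunDecay c (q : Measure (EuclideanSpace ℝ (Fin d))) :=
    hest.mono fun L hL n z q hq => hdec𝒦 q (h𝔔 _ (hL n z).1 q hq)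
  obtain ⟨γ', hγ', hreg'⟩ := hχ.cluster_function Λ hΛ Ω hΩ
  -- The cluster function comes with its own numbering `γ'` of the atoms. This permutation depends
  -- only on the two numberings, hence not on the sample.
  obtain ⟨σ, hσ⟩ := hγ.exists_perm hγ'
  have hreg := hreg'.perm hσ
  refine ⟨fun k => ⟨_, (hreg.charFunDecay hγ hdecΩ k).isContDensity hc⟩, fun hnear => ⟨σ, ?_⟩,
    fun hwell hcard hsl => ?_⟩
  · filter_upwards [NPMix.ae_eventually_of_eventually_ae hcons,
      NPMix.ae_eventually_of_eventually_ae hnear] with s hW hn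
    refine NPMix.partitionConsistent_of_follows hr hc hγ hreg hdecΩ
      (hdecest.mono fun L hL n => hL n _) hW ?_
    filter_upwards [hn] with L hL
    obtain ⟨δ, hsep, hδ⟩ :=
      ((NPMix.eventually_le_hellinger (Ω L).atoms).and self_mem_nhdsWithin).exists
    refine ⟨δ, hδ, hL.mono fun n hn p hp q hq hpq => ?_⟩
    rw [hn.eq_of_hellinger_lt hsep hp hq hpq]
  -- The estimates are compared with the assignment sequence from the separation hypothesis, which
  -- may differ from that of `χ`.
  · obtain ⟨α, hregα, hsep⟩ := hwell.eventually_lt_hellinger hγ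
    have hpos : ∀ᶠ L in atTop, ∀ k, 0 < NPMix.clusterWeight (Ω L) (α L) k :=
      Filter.eventually_all.2 fun k => hregα.eventually_clusterWeight_pos hγ k
    filter_upwards [NPMix.ae_eventually_of_eventually_ae hcons,
      NPMix.ae_eventually_of_eventually_ae hcard,
      NPMix.ae_eventually_of_eventually_ae hsl] with s hW hcd hs
    have hex : ∀ᶠ L in atTop, ∃ δ > 0, ∀ᶠ n in atTop, ∃ τ : Equiv.Perm (Fin K),
        ∀ p ∈ (est L n fun i : Fin n => Z i s).atoms, ∀ q ∈ (Ω L).atoms,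
          NPMix.hellinger (p : Measure (EuclideanSpace ℝ (Fin d)))
            (q : Measure (EuclideanSpace ℝ (Fin d))) < δ →
          τ (αhat L n (fun i : Fin n => Z i s) p) = α L q := by
      filter_upwards [hW, hcd, hs, hsep, hpos] with L h1 h2 h3 h4 h5
      refine NPMix.eventually_exists_perm_singleLinkage hr h1 h2 h3 (fun k => ?_)
        (fun q hq q' hq' => NPMix.hellinger_le_etaWidth_of_eq γ hq hq') h4
      obtain ⟨q, hq⟩ := NPMix.cluster_nonempty_of_clusterWeight_pos (h5 k)
      exact ⟨q, Finset.mem_filter.1 hq⟩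
    obtain ⟨L₀, hL₀⟩ := eventually_atTop.1 hex
    choose! δ hδ hτ using hL₀
    -- A matching permutation is chosen for each `L` and `n`; where none exists the choice is
    -- arbitrary, which affects no limit.
    refine ⟨fun L n => Classical.epsilon fun τ : Equiv.Perm (Fin K) =>
      ∀ p ∈ (est L n fun i : Fin n => Z i s).atoms, ∀ q ∈ (Ω L).atoms,
          NPMix.hellinger (p : Measure (EuclideanSpace ℝ (Fin d)))
            (q : Measure (EuclideanSpace ℝ (Fin d))) < δ L →
          τ (αhat L n (fun i : Fin n => Z i s) p) = α L q, ?_⟩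
    refine NPMix.partitionConsistent_of_follows hr hc hγ hregα hdecΩ
      (hdecest.mono fun L hL n => hL n _) hW ?_
    filter_upwards [eventually_ge_atTop L₀] with L hL
    exact ⟨δ L, hδ L hL, (hτ L hL).mono fun n hn => Classical.epsilon_spec hn⟩
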